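/- Let $\mathcal S$ be the Schwartz space of (complex-valued) rapidly decreasing smooth functions on $\mathbb R$ and $\mathcal S'$ its dual, the space of tempered distributions. For $m\in\mathbb N_0$ put $\|\varphi\|_m=\big(\int_{\mathbb R}|(N+1)^m\varphi(x)|^2dx\big)^{1/2}$, where $N+1=\frac12\big(-\frac{d^2}{dx^2}+x^2+1\big)$. Let $\mathbf s$ be the set of real sequences $(a_n)_{n\ge0}$ with $\sum_n (n+1)^{2l}|a_n|^2<\infty$ for all $l\in\mathbb N_0$, and $\mathbf s'$ the set of real sequences with $|a_n|\le C(n+1)^l$ for all $n$, for some $C$ and $l$. Define $$\mathcal H_{\mathbf s'}=\{(f_n)\in\mathcal S^{\mathbb N_0}: (\|f_n\|_m)_n\in\mathbf s'\ \text{for all } m\},\qquad \mathcal H_{\mathbf s}=\{(f_n)\in\mathcal S^{\mathbb N_0}: (\|f_n\|_m)_n\in\mathbf s\ \text{for all } m\},$$ and $\mathcal H=\mathcal H_{\mathbf s'}/\mathcal H_{\mathbf s}$, with classes $[f_n]$. On $\mathcal H$ put $[f_n]\cdot[g_n]=[f_ng_n]$, $D[f_n]=[Df_n]$ and $\mathcal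 F([f_n])=[\mathcal F(f_n)]$, where $\mathcal F(\varphi)(t)=\frac1{\sqrt{2\pi}}\int_{\mathbb R}e^{-itx}\varphi(x)\,dx$; these are well defined and $\mathcal F$ is a linear automorphism of $\mathcal H$. The convolution on $\mathcal H$ is defined by $$u*v=\mathcal F^{-1}\big(\sqrt{2\pi}\,\mathcal F(u)\cdot\mathcal F(v)\big),$$ and on $\mathcal S$ by $(\varphi*\psi)(t)=\int_{\mathbb R}\varphi(t-x)\psi(x)\,dx$. For $T\in\mathcal S'$ and $\varphi\in\mathcal S$ let $T*\varphi\in\mathcal S'$ be given by $(T*\varphi)(\psi)=T(\tilde\varphi*\psi)$ with $\tilde\varphi(x)=\varphi(-x)$. Let $h_j(x)=(\sqrt{2\pi}\,j!)^{-1/2}e^{-x^2/4}H_j(x)$, with $H_j(x)=(-1)^je^{x^2/2}\frac{d^j}{dx^j}e^{-x^2/2}$, be the Hermite functions, and let $\iota:\mathcal S'\to\mathcal H$ be $\iota(T)=[T_n]$ with $T_n=\sum_{j=0}^nT(h_j)h_j$; a function $\varphi\in\mathcal S$ is regarded as the distribution $\psi\mapsto\int\varphi\psi\,dx$. Write $[f_n]\approx[g_n]$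 (association) if $\lim_{n\to\infty}\int_{\mathbb R}(f_n-g_n)\varphi\,dx=0$ for all $\varphi\in\mathcal S$. **Theorem.** a) If $[f_n],[g_n]\in\mathcal H$, then $(f_n*g_n)\in\mathcal H_{\mathbf s'}$ and $[f_n]*[g_n]=[f_n*g_n]$. b) For all $u,v,w\in\mathcal H$ and $\alpha\in\mathbb N_0$: $u*v=v*u$, $\;D^\alpha(u*v)=(D^\alpha u)*v$, and $(u*v)*w=u*(v*w)$. c) For all $u,v\in\mathcal H$: $\mathcal F(u\cdot v)=\frac1{\sqrt{2\pi}}\,\mathcal F(u)*\mathcal F(v)$ and $\mathcal F(u*v)=\sqrt{2\pi}\,\mathcal F(u)\cdot\mathcal F(v)$. d) For all $T\in\mathcal S'$ and $\varphi\in\mathcal S$: $\iota(T)*\iota(\varphi)\approx\iota(T*\varphi)$. -/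

import Mathlib

open MeasureTheory Filter Topology
open scoped SchwartzMap

noncomputable section

namespace TGF

/-! ### Operators on the Schwartz space of complex-valued functions on the line -/

/-- The derivative `D` on the Schwartz space. -/
def D : 𝓢(ℝ, ℂ) →L[ℂ] 𝓢(ℝ, ℂ) := SchwartzMap.derivCLM ℂ ℂ

/-- Multiplication by the coordinate `x` on the Schwartz space. -/
def X : 𝓢(ℝ, ℂ) →L[ℂ] 𝓢(ℝ, ℂ) := SchwartzMap.smulLeftCLM ℂ (fun x : ℝ => (x : ℂ))

theorem D_apply (φ : 𝓢(ℝ, ℂ)) (x : ℝ) : D φ x = deriv φ x := rfl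

theorem X_apply (φ : 𝓢(ℝ, ℂ)) (x : ℝ) : X φ x = (x : ℂ) * φ x := by
  rw [X, SchwartzMap.smulLeftCLM_apply_apply (by fun_prop), smul_eq_mul]

/-- The operator `N + 1 = (1/2) (-d²/dx² + x² + 1)` on the Schwartz space. -/
def osc : 𝓢(ℝ, ℂ) →L[ℂ] 𝓢(ℝ, ℂ) :=
  (1 / 2 : ℂ) • (-(D ∘L D) + X ∘L X + ContinuousLinearMap.id ℂ 𝓢(ℝ, ℂ))

theorem osc_eq (φ : 𝓢(ℝ, ℂ)) : osc φ = (1 / 2 : ℂ) • (-(D (D φ)) + X (X φ) + φ) := rfl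

/-- The norm `‖φ‖_m = (∫ |(N + 1)^m φ(x)|² dx)^{1/2}`. -/
def hnorm (m : ℕ) (φ : 𝓢(ℝ, ℂ)) : ℝ := √(∫ x : ℝ, ‖((osc ^ m) φ) x‖ ^ 2)

/-- The pointwise product of Schwartz functions. -/
def sprod (φ ψ : 𝓢(ℝ, ℂ)) : 𝓢(ℝ, ℂ) :=
  SchwartzMap.pairing (ContinuousLinearMap.mul ℂ ℂ) φ ψ

theorem sprod_apply (φ ψ : 𝓢(ℝ, ℂ)) (x : ℝ) : sprod φ ψ x = φ x * ψ x := rfl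

/-- The convolution of Schwartz functions; see `sconv_apply` for the integral formula. -/
def sconv (φ ψ : 𝓢(ℝ, ℂ)) : 𝓢(ℝ, ℂ) :=
  SchwartzMap.convolution (ContinuousLinearMap.mul ℂ ℂ) φ ψ

theorem sconv_apply (φ ψ : 𝓢(ℝ, ℂ)) (t : ℝ) : sconv φ ψ t = ∫ x : ℝ, φ (t - x) * ψ x := by
  rw [sconv, SchwartzMap.convolution_apply, ← convolution_flip]
  simp only [convolution_def, ContinuousLinearMap.flip_apply, ContinuousLinearMap.mul_apply']

/-- The dilation `x ↦ c x` of the line, for `c ≠ 0`. -/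
def dil (c : ℝ) (hc : c ≠ 0) : ℝ ≃L[ℝ] ℝ := ContinuousLinearEquiv.unitsEquivAut ℝ (Units.mk0 c hc)

theorem dil_apply (c : ℝ) (hc : c ≠ 0) (x : ℝ) : dil c hc x = x * c := rfl

theorem dil_symm_apply (c : ℝ) (hc : c ≠ 0) (x : ℝ) : (dil c hc).symm x = x * c⁻¹ := rfl

/-- Precomposition of a Schwartz function with a dilation. -/
def dilS (c : ℝ) (hc : c ≠ 0) : 𝓢(ℝ, ℂ) ≃L[ℂ] 𝓢(ℝ, ℂ) :=
  ContinuousLinearEquiv.equivOfInverse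
    (SchwartzMap.compCLMOfContinuousLinearEquiv ℂ (dil c hc))
    (SchwartzMap.compCLMOfContinuousLinearEquiv ℂ (dil c hc).symm)
    (fun φ => by ext x; simp)
    (fun φ => by ext x; simp)

theorem dilS_apply (c : ℝ) (hc : c ≠ 0) (φ : 𝓢(ℝ, ℂ)) (x : ℝ) : dilS c hc φ x = φ (x * c) := rfl

theorem two_pi_inv_ne : (2 * Real.pi)⁻¹ ≠ 0 := by positivity

theorem sqrt_two_pi_inv_ne : ((√(2 * Real.pi) : ℝ) : ℂ)⁻¹ ≠ 0 := by
  have : √(2 * Real.pi) ≠ 0 := by positivity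
  exact inv_ne_zero (by exact_mod_cast this)

/-- The Fourier transform of Schwartz functions with the unitary, angular frequency normalization;
see `fourierS_apply` for the integral formula. -/
def fourierS : 𝓢(ℝ, ℂ) ≃L[ℂ] 𝓢(ℝ, ℂ) :=
  ((FourierTransform.fourierCLE ℂ 𝓢(ℝ, ℂ)).trans (dilS (2 * Real.pi)⁻¹ two_pi_inv_ne)).trans
    (ContinuousLinearEquiv.smulLeft (Units.mk0 _ sqrt_two_pi_inv_ne))

theorem fourierS_apply (φ : 𝓢(ℝ, ℂ)) (t : ℝ) :
    fourierS φ t =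
      ((√(2 * Real.pi) : ℝ) : ℂ)⁻¹ * ∫ x : ℝ, Complex.exp (-(Complex.I * t * x)) * φ x := by
  have h : fourierS φ t = ((√(2 * Real.pi) : ℝ) : ℂ)⁻¹ *
      (FourierTransform.fourier φ : 𝓢(ℝ, ℂ)) (t * (2 * Real.pi)⁻¹) := rfl
  rw [h, SchwartzMap.fourier_coe, Real.fourier_eq']
  congr 2
  ext x
  rw [smul_eq_mul]
  congr 2
  have : (Real.pi : ℂ) ≠ 0 := by exact_mod_cast Real.pi_ne_zero
  simp only [RCLike.inner_apply, conj_trivial]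
  push_cast
  field_simp

/-! ### L² estimates -/

/-- The embedding of the Schwartz space in `L²`. -/
def L2 : 𝓢(ℝ, ℂ) →L[ℂ] Lp ℂ 2 (volume : Measure ℝ) := SchwartzMap.toLpCLM ℂ ℂ 2 volume

theorem hnorm_eq (m : ℕ) (φ : 𝓢(ℝ, ℂ)) : hnorm m φ = ‖L2 ((osc ^ m) φ)‖ := by
  have h := SchwartzMap.norm_toLp' (f := (osc ^ m) φ) (p := 2) (μ := volume) (by simp) (by simp)
  rw [L2, SchwartzMap.toLpCLM_apply, h, hnorm, Real.sqrt_eq_rpow]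
  simp

theorem inner_L2 (φ ψ : 𝓢(ℝ, ℂ)) :
    inner ℂ (L2 φ) (L2 ψ) = ∫ x : ℝ, (starRingEnd ℂ) (φ x) * ψ x := by
  refine (SchwartzMap.inner_toL2_toL2_eq φ ψ volume).trans ?_
  simp [mul_comm]

theorem inner_X (φ ψ : 𝓢(ℝ, ℂ)) : inner ℂ (L2 (X φ)) (L2 ψ) = inner ℂ (L2 φ) (L2 (X ψ)) := by
  simp only [inner_L2, X_apply, map_mul, Complex.conj_ofReal]
  congr 1; ext x; ring

theorem inner_D (φ ψ : 𝓢(ℝ, ℂ)) : inner ℂ (L2 (D φ)) (L2 ψ) = -inner ℂ (L2 φ) (L2 (D ψ)) := by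
  have h := SchwartzMap.integral_bilinear_deriv_right_eq_neg_left φ ψ
    ((ContinuousLinearMap.mul ℝ ℂ).comp (Complex.conjCLE : ℂ →L[ℝ] ℂ))
  simp only [inner_L2, D_apply]
  simp only [ContinuousLinearMap.comp_apply, ContinuousLinearMap.mul_apply',
    ContinuousLinearEquiv.coe_coe, Complex.conjCLE_apply] at h
  rw [h, neg_neg]

theorem DX (φ : 𝓢(ℝ, ℂ)) : D (X φ) = X (D φ) + φ := by
  ext x
  have h1 : HasDerivAt (fun x : ℝ => (x : ℂ) * φ x) (1 * φ x + x * deriv φ x) x :=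
    (Complex.ofRealCLM.hasDerivAt (x := x)).mul (φ.hasDerivAt x)
  have h2 : (X φ : ℝ → ℂ) = fun x : ℝ => (x : ℂ) * φ x := by ext y; exact X_apply φ y
  rw [D_apply, h2, h1.deriv]
  simp [X_apply, D_apply]; ring

theorem osc_X (φ : 𝓢(ℝ, ℂ)) : osc (X φ) = X (osc φ) - D φ := by
  simp only [osc_eq, DX, map_smul, map_add, map_neg]; module

theorem osc_D (φ : 𝓢(ℝ, ℂ)) : osc (D φ) = D (osc φ) - X φ := by
  simp only [osc_eq, DX, map_smul, map_add, map_neg]; module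

theorem osc_AB (φ : 𝓢(ℝ, ℂ)) : X (X φ - D φ) + D (X φ - D φ) = (2 : ℂ) • osc φ := by
  simp only [osc_eq, DX, map_sub]; module

theorem osc_BA (φ : 𝓢(ℝ, ℂ)) : X (X φ + D φ) - D (X φ + D φ) = (2 : ℂ) • (osc φ - φ) := by
  simp only [osc_eq, DX, map_add]; module

theorem norm_A_sq (φ : 𝓢(ℝ, ℂ)) :
    ‖L2 (X φ + D φ)‖ ^ 2 = 2 * (inner ℂ (L2 φ) (L2 (osc φ - φ))).re := by
  have h : inner ℂ (L2 (X φ + D φ)) (L2 (X φ + D φ)) = 2 * inner ℂ (L2 φ) (L2 (osc φ - φ)) := by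
    rw [← inner_smul_right, ← map_smul, ← osc_BA, map_add, inner_add_left, ← map_add, inner_X,
      inner_D, map_sub, inner_sub_right, sub_eq_add_neg]
  rw [← inner_self_eq_norm_sq (𝕜 := ℂ), h]
  simp

theorem norm_B_sq (φ : 𝓢(ℝ, ℂ)) :
    ‖L2 (X φ - D φ)‖ ^ 2 = 2 * (inner ℂ (L2 φ) (L2 (osc φ))).re := by
  have h : inner ℂ (L2 (X φ - D φ)) (L2 (X φ - D φ)) = 2 * inner ℂ (L2 φ) (L2 (osc φ)) := by
    rw [← inner_smul_right, ← map_smul, ← osc_AB, map_sub, inner_sub_left, ← map_sub, inner_X,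
      inner_D, map_add, inner_add_right, sub_neg_eq_add]
  rw [← inner_self_eq_norm_sq (𝕜 := ℂ), h]
  simp

theorem norm_osc_sq (φ : 𝓢(ℝ, ℂ)) :
    ‖L2 (osc φ)‖ ^ 2 = ‖L2 (osc φ - φ)‖ ^ 2 + ‖L2 (X φ + D φ)‖ ^ 2 + ‖L2 φ‖ ^ 2 := by
  rw [norm_A_sq]
  have := norm_add_sq (𝕜 := ℂ) (L2 φ) (L2 (osc φ - φ))
  rw [← map_add, add_sub_cancel] at this
  rw [this]
  simp; ring

theorem norm_le_osc (φ : 𝓢(ℝ, ℂ)) : ‖L2 φ‖ ≤ ‖L2 (osc φ)‖ := by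
  have := norm_osc_sq φ
  refine abs_le_of_sq_le_sq' ?_ (norm_nonneg _) |>.2
  nlinarith [sq_nonneg ‖L2 (osc φ - φ)‖, sq_nonneg ‖L2 (X φ + D φ)‖]

theorem norm_A_le (φ : 𝓢(ℝ, ℂ)) : ‖L2 (X φ + D φ)‖ ≤ ‖L2 (osc φ)‖ := by
  have := norm_osc_sq φ
  refine abs_le_of_sq_le_sq' ?_ (norm_nonneg _) |>.2
  nlinarith [sq_nonneg ‖L2 (osc φ - φ)‖, sq_nonneg ‖L2 φ‖]

theorem norm_B_le (φ : 𝓢(ℝ, ℂ)) : ‖L2 (X φ - D φ)‖ ≤ 2 * ‖L2 (osc φ)‖ := by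
  have h1 := norm_B_sq φ
  have h2 : (inner ℂ (L2 φ) (L2 (osc φ))).re ≤ ‖L2 φ‖ * ‖L2 (osc φ)‖ :=
    re_inner_le_norm (𝕜 := ℂ) _ _
  have h3 := norm_le_osc φ
  have h4 := norm_nonneg (L2 (osc φ))
  refine abs_le_of_sq_le_sq' ?_ (by positivity) |>.2
  nlinarith

theorem norm_X_le (φ : 𝓢(ℝ, ℂ)) : ‖L2 (X φ)‖ ≤ 2 * ‖L2 (osc φ)‖ := by
  have h : X φ = (1 / 2 : ℂ) • ((X φ + D φ) + (X φ - D φ)) := by module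
  have hc : ‖(1 / 2 : ℂ)‖ = 1 / 2 := by norm_num
  rw [h, map_smul, norm_smul, L2.map_add (X φ + D φ), hc]
  have := norm_add_le (L2 (X φ + D φ)) (L2 (X φ - D φ))
  have h1 := norm_A_le φ
  have h2 := norm_B_le φ
  have h4 := norm_nonneg (L2 (osc φ))
  linarith

theorem norm_D_le (φ : 𝓢(ℝ, ℂ)) : ‖L2 (D φ)‖ ≤ 2 * ‖L2 (osc φ)‖ := by
  have h : D φ = (1 / 2 : ℂ) • ((X φ + D φ) - (X φ - D φ)) := by module
  have hc : ‖(1 / 2 : ℂ)‖ = 1 / 2 := by norm_num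
  rw [h, map_smul, norm_smul, L2.map_sub (X φ + D φ), hc]
  have := norm_sub_le (L2 (X φ + D φ)) (L2 (X φ - D φ))
  have h1 := norm_A_le φ
  have h2 := norm_B_le φ
  have h4 := norm_nonneg (L2 (osc φ))
  linarith

/-! ### The norms `hnorm m` generate the Schwartz topology -/

theorem hnorm_nonneg (m : ℕ) (φ : 𝓢(ℝ, ℂ)) : 0 ≤ hnorm m φ := Real.sqrt_nonneg _

theorem hnorm_add_le (m : ℕ) (φ ψ : 𝓢(ℝ, ℂ)) : hnorm m (φ + ψ) ≤ hnorm m φ + hnorm m ψ := by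
  simp only [hnorm_eq, map_add]; exact norm_add_le _ _

theorem hnorm_sub_le (m : ℕ) (φ ψ : 𝓢(ℝ, ℂ)) : hnorm m (φ - ψ) ≤ hnorm m φ + hnorm m ψ := by
  simp only [hnorm_eq, map_sub]; exact norm_sub_le _ _

theorem hnorm_smul (m : ℕ) (c : ℂ) (φ : 𝓢(ℝ, ℂ)) : hnorm m (c • φ) = ‖c‖ * hnorm m φ := by
  simp only [hnorm_eq, map_smul, norm_smul]

theorem hnorm_zero_right (m : ℕ) : hnorm m 0 = 0 := by simp [hnorm_eq]

theorem hnorm_succ (m : ℕ) (φ : 𝓢(ℝ, ℂ)) : hnorm (m + 1) φ = hnorm m (osc φ) := by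
  rw [hnorm_eq, hnorm_eq, pow_succ]; rfl

theorem hnorm_le_succ (m : ℕ) (φ : 𝓢(ℝ, ℂ)) : hnorm m φ ≤ hnorm (m + 1) φ := by
  rw [hnorm_eq, hnorm_eq, pow_succ']; exact norm_le_osc _

theorem hnorm_mono (φ : 𝓢(ℝ, ℂ)) : Monotone (fun m => hnorm m φ) :=
  monotone_nat_of_le_succ fun m => hnorm_le_succ m φ

theorem hnorm_XD_le (m : ℕ) : ∃ C : ℝ, 0 ≤ C ∧ ∀ φ : 𝓢(ℝ, ℂ),
    hnorm m (X φ) ≤ C * hnorm (m + 1) φ ∧ hnorm m (D φ) ≤ C * hnorm (m + 1) φ := by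
  induction m with
  | zero =>
    refine ⟨2, by norm_num, fun φ => ⟨?_, ?_⟩⟩
    · simpa [hnorm_eq] using norm_X_le φ
    · simpa [hnorm_eq] using norm_D_le φ
  | succ m ih =>
    obtain ⟨C, hC, h⟩ := ih
    refine ⟨2 * C, by positivity, fun φ => ?_⟩
    have h1 := h φ
    have h2 := h (osc φ)
    have h3 := mul_le_mul_of_nonneg_left (hnorm_le_succ (m + 1) φ) hC
    rw [← hnorm_succ] at h2
    constructor
    · rw [hnorm_succ, osc_X]
      have := hnorm_sub_le m (X (osc φ)) (D φ)
      linarith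
    · rw [hnorm_succ, osc_D]
      have := hnorm_sub_le m (D (osc φ)) (X φ)
      linarith

theorem hnorm_pow_le (k l : ℕ) : ∀ m : ℕ, ∃ C : ℝ, 0 ≤ C ∧ ∀ φ : 𝓢(ℝ, ℂ),
    hnorm m ((X ^ k) ((D ^ l) φ)) ≤ C * hnorm (m + k + l) φ := by
  induction k with
  | zero =>
    induction l with
    | zero => exact fun m => ⟨1, by norm_num, fun φ => by simp⟩
    | succ l ih =>
      intro m
      obtain ⟨C, hC, h⟩ := ih m
      obtain ⟨C', hC', h'⟩ := hnorm_XD_le (m + l)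
      refine ⟨C * C', by positivity, fun φ => ?_⟩
      have := h (D φ)
      rw [pow_succ]
      calc _ ≤ C * hnorm (m + 0 + l) (D φ) := this
        _ ≤ C * (C' * hnorm (m + l + 1) φ) := by
          gcongr; exact (h' φ).2
        _ = _ := by rw [mul_assoc]; rfl
  | succ k ih =>
    intro m
    obtain ⟨C, hC, h⟩ := ih (m + 1)
    obtain ⟨C', hC', h'⟩ := hnorm_XD_le m
    refine ⟨C' * C, by positivity, fun φ => ?_⟩
    rw [pow_succ']
    calc _ ≤ C' * hnorm (m + 1) ((X ^ k) ((D ^ l) φ)) := (h' _).1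
      _ ≤ C' * (C * hnorm (m + 1 + k + l) φ) := by gcongr; exact h φ
      _ = _ := by rw [mul_assoc]; congr 3; omega

theorem sup_le (φ : 𝓢(ℝ, ℂ)) (x : ℝ) : ‖φ x‖ ^ 2 ≤ ‖L2 φ‖ ^ 2 + ‖L2 (D φ)‖ ^ 2 := by
  have hn : ∀ ψ : 𝓢(ℝ, ℂ), ‖L2 ψ‖ ^ 2 = ∫ x : ℝ, ‖ψ x‖ ^ 2 := fun ψ => by
    have h0 : ‖L2 ψ‖ = hnorm 0 ψ := by simp [hnorm_eq]
    rw [h0, hnorm, Real.sq_sqrt (by positivity)]; rfl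
  have hi : ∀ ψ : 𝓢(ℝ, ℂ), Integrable (fun x : ℝ => ‖ψ x‖ ^ 2) := fun ψ => by
    have := (sprod ψ ψ).integrable (μ := volume) |>.norm
    refine this.congr (Eventually.of_forall fun x => ?_)
    simp [sprod_apply, sq]
  have hd : ∀ y ∈ Set.Iic x, HasDerivAt (sprod φ φ : ℝ → ℂ) (D (sprod φ φ) y) y := fun y _ =>
    (sprod φ φ).hasDerivAt y
  have hD : ∀ y, D (sprod φ φ) y = 2 * (φ y * D φ y) := fun y => by
    have h1 := (φ.hasDerivAt y).mul (φ.hasDerivAt y)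
    have h2 : (sprod φ φ : ℝ → ℂ) = φ * φ := rfl
    rw [D_apply, h2, h1.deriv, D_apply]; ring
  have ht : Tendsto (sprod φ φ : ℝ → ℂ) atBot (𝓝 0) :=
    (sprod φ φ).tendsto_cocompact.mono_left atBot_le_cocompact
  have h := integral_Iic_of_hasDerivAt_of_tendsto' hd (D (sprod φ φ)).integrable.integrableOn ht
  rw [sub_zero, sprod_apply] at h
  calc ‖φ x‖ ^ 2 = ‖φ x * φ x‖ := by rw [norm_mul, sq]
    _ = ‖∫ y in Set.Iic x, D (sprod φ φ) y‖ := by rw [h]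
    _ ≤ ∫ y in Set.Iic x, ‖D (sprod φ φ) y‖ := norm_integral_le_integral_norm _
    _ ≤ ∫ y, ‖D (sprod φ φ) y‖ :=
      setIntegral_le_integral (D (sprod φ φ)).integrable.norm
        (Eventually.of_forall fun y => norm_nonneg _)
    _ ≤ ∫ y, (‖φ y‖ ^ 2 + ‖D φ y‖ ^ 2) := by
      refine integral_mono (D (sprod φ φ)).integrable.norm ((hi φ).add (hi (D φ))) fun y => ?_
      simp only [hD, norm_mul, Complex.norm_ofNat]
      nlinarith [sq_nonneg (‖φ y‖ - ‖D φ y‖)]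
    _ = _ := by rw [integral_add (hi φ) (hi (D φ)), hn, hn]

theorem sup_le_hnorm (φ : 𝓢(ℝ, ℂ)) (x : ℝ) : ‖φ x‖ ≤ 3 * hnorm 1 φ := by
  have h1 := sup_le φ x
  have h2 := norm_le_osc φ
  have h3 := norm_D_le φ
  have h4 : hnorm 1 φ = ‖L2 (osc φ)‖ := by simp [hnorm_eq]
  rw [h4]
  refine abs_le_of_sq_le_sq' ?_ (by positivity) |>.2
  nlinarith [norm_nonneg (L2 φ), norm_nonneg (L2 (D φ)), norm_nonneg (L2 (osc φ))]

theorem X_pow_apply (k : ℕ) (φ : 𝓢(ℝ, ℂ)) (x : ℝ) : (X ^ k) φ x = (x : ℂ) ^ k * φ x := by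
  induction k with
  | zero => simp
  | succ k ih =>
    rw [pow_succ']
    change X ((X ^ k) φ) x = _
    rw [X_apply, ih]; ring

theorem D_pow_coe (l : ℕ) (φ : 𝓢(ℝ, ℂ)) : ((D ^ l) φ : ℝ → ℂ) = iteratedDeriv l φ := by
  induction l with
  | zero => simp
  | succ l ih =>
    rw [pow_succ', iteratedDeriv_succ, ← ih]; rfl

theorem seminorm_le_hnorm (k l : ℕ) : ∃ (r : ℕ) (C : ℝ), 0 ≤ C ∧ ∀ φ : 𝓢(ℝ, ℂ),
    SchwartzMap.seminorm ℂ k l φ ≤ C * hnorm r φ := by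
  obtain ⟨C, hC, h⟩ := hnorm_pow_le k l 1
  refine ⟨1 + k + l, 3 * C, by positivity, fun φ => ?_⟩
  refine SchwartzMap.seminorm_le_bound' ℂ k l φ
    (mul_nonneg (by positivity) (hnorm_nonneg _ _)) fun x => ?_
  have h1 := sup_le_hnorm ((X ^ k) ((D ^ l) φ)) x
  rw [X_pow_apply, D_pow_coe, norm_mul, norm_pow, Complex.norm_real, Real.norm_eq_abs] at h1
  have h2 := h φ
  linarith

/-- Every continuous seminorm is controlled by one of the norms `hnorm r`. -/
theorem seminorm_bound (q : Seminorm ℂ 𝓢(ℝ, ℂ)) (hq : Continuous q) :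
    ∃ (r : ℕ) (C : ℝ), 0 ≤ C ∧ ∀ φ, q φ ≤ C * hnorm r φ := by
  obtain ⟨s, C, -, h⟩ := Seminorm.bound_of_continuous (schwartz_withSeminorms ℂ ℝ ℂ) q hq
  choose r K hK hr using seminorm_le_hnorm
  refine ⟨s.sup fun i => r i.1 i.2, C * ∑ i ∈ s, K i.1 i.2,
    mul_nonneg C.2 (Finset.sum_nonneg fun i _ => hK _ _), fun φ => ?_⟩
  have h1 : q φ ≤ C * (s.sup (schwartzSeminormFamily ℂ ℝ ℂ)) φ := h φ
  have h2 : (s.sup (schwartzSeminormFamily ℂ ℝ ℂ)) φ ≤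
      (∑ i ∈ s, schwartzSeminormFamily ℂ ℝ ℂ i) φ := Seminorm.finset_sup_le_sum _ s φ
  have h3 : (∑ i ∈ s, schwartzSeminormFamily ℂ ℝ ℂ i) φ =
      ∑ i ∈ s, schwartzSeminormFamily ℂ ℝ ℂ i φ := by
    induction s using Finset.cons_induction with
    | empty => simp
    | cons a s ha ih => simp
  have h4 : ∑ i ∈ s, schwartzSeminormFamily ℂ ℝ ℂ i φ ≤
      ∑ i ∈ s, K i.1 i.2 * hnorm (s.sup fun i => r i.1 i.2) φ := by
    refine Finset.sum_le_sum fun i hi => (hr i.1 i.2 φ).trans ?_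
    refine mul_le_mul_of_nonneg_left (hnorm_mono φ ?_) (hK _ _)
    exact Finset.le_sup (f := fun i : ℕ × ℕ => r i.1 i.2) hi
  rw [← Finset.sum_mul] at h4
  rw [mul_assoc]
  exact h1.trans (mul_le_mul_of_nonneg_left (h2.trans (h3.le.trans h4)) C.2)

theorem map_bound (A : 𝓢(ℝ, ℂ) →L[ℂ] 𝓢(ℝ, ℂ)) (m : ℕ) :
    ∃ (r : ℕ) (C : ℝ), 0 ≤ C ∧ ∀ φ, hnorm m (A φ) ≤ C * hnorm r φ := by
  obtain ⟨r, C, hC, h⟩ := seminorm_bound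
    ((normSeminorm ℂ (Lp ℂ 2 (volume : Measure ℝ))).comp
      ((L2 ∘L (osc ^ m) ∘L A : 𝓢(ℝ, ℂ) →L[ℂ] Lp ℂ 2 (volume : Measure ℝ)) :
        𝓢(ℝ, ℂ) →ₗ[ℂ] Lp ℂ 2 (volume : Measure ℝ)))
    (continuous_norm.comp (L2 ∘L (osc ^ m) ∘L A).continuous)
  exact ⟨r, C, hC, fun φ => by rw [hnorm_eq]; exact h φ⟩

theorem functional_bound (T : 𝓢'(ℝ, ℂ)) :
    ∃ (r : ℕ) (C : ℝ), 0 ≤ C ∧ ∀ φ, ‖T φ‖ ≤ C * hnorm r φ :=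
  seminorm_bound ((normSeminorm ℂ ℂ).comp (T : 𝓢(ℝ, ℂ) →ₗ[ℂ] ℂ))
    (continuous_norm.comp (ContinuousLinearMap.continuous (σ₁₂ := RingHom.id ℂ) T))

theorem osc_sprod (φ ψ : 𝓢(ℝ, ℂ)) : osc (sprod φ ψ) = (1 / 2 : ℂ) •
    (sprod (X (X φ)) ψ + sprod φ ψ - sprod (D (D φ)) ψ - (2 : ℂ) • sprod (D φ) (D ψ) -
      sprod φ (D (D ψ))) := by
  have hD : ∀ φ ψ : 𝓢(ℝ, ℂ), D (sprod φ ψ) = sprod (D φ) ψ + sprod φ (D ψ) := fun φ ψ => by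
    ext y
    have h1 := (φ.hasDerivAt y).mul (ψ.hasDerivAt y)
    have h2 : (sprod φ ψ : ℝ → ℂ) = φ * ψ := rfl
    rw [D_apply, h2, h1.deriv]; simp [sprod_apply, D_apply]
  have hX : ∀ φ ψ : 𝓢(ℝ, ℂ), X (sprod φ ψ) = sprod (X φ) ψ := fun φ ψ => by
    ext y; simp [sprod_apply, X_apply, mul_assoc]
  rw [osc_eq, hD, map_add, hD, hD, hX, hX]
  module

theorem sprod_bound (m : ℕ) : ∃ (r : ℕ) (C : ℝ), 0 ≤ C ∧ ∀ φ ψ : 𝓢(ℝ, ℂ),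
    hnorm m (sprod φ ψ) ≤ C * hnorm r φ * hnorm r ψ := by
  induction m with
  | zero =>
    refine ⟨1, 3, by norm_num, fun φ ψ => ?_⟩
    have h1 : hnorm 0 (sprod φ ψ) ≤ (3 * hnorm 1 φ) * hnorm 0 ψ := by
      simp only [hnorm, pow_zero, one_apply_eq_self]
      have hi : ∀ ψ : 𝓢(ℝ, ℂ), Integrable (fun x : ℝ => ‖ψ x‖ ^ 2) := fun ψ => by
        have := (sprod ψ ψ).integrable (μ := volume) |>.norm
        refine this.congr (Eventually.of_forall fun x => ?_)
        simp [sprod_apply, sq]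
      have h0 : 0 ≤ 3 * hnorm 1 φ := mul_nonneg (by norm_num) (hnorm_nonneg _ _)
      refine Real.sqrt_le_iff.2 ⟨mul_nonneg h0 (Real.sqrt_nonneg _), ?_⟩
      rw [mul_pow, Real.sq_sqrt (by positivity), ← integral_const_mul]
      refine integral_mono (hi _) ((hi ψ).const_mul _) fun x => ?_
      simp only [sprod_apply, norm_mul, mul_pow]
      exact mul_le_mul_of_nonneg_right (by
        have := pow_le_pow_left₀ (norm_nonneg _) (sup_le_hnorm φ x) 2
        rwa [mul_pow] at this) (sq_nonneg _)
    refine h1.trans (mul_le_mul_of_nonneg_left (hnorm_le_succ 0 ψ) ?_)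
    exact mul_nonneg (by norm_num) (hnorm_nonneg _ _)
  | succ m ih =>
    obtain ⟨r, C, hC, h⟩ := ih
    obtain ⟨C1, hC1, h1⟩ := hnorm_XD_le r
    obtain ⟨C2, hC2, h2⟩ := hnorm_XD_le (r + 1)
    have hDD : ∀ φ, hnorm r (D (D φ)) ≤ C1 * C2 * hnorm (r + 2) φ := fun φ => by
      rw [mul_assoc]
      exact ((h1 _).2).trans (mul_le_mul_of_nonneg_left (h2 φ).2 hC1)
    have hXX : ∀ φ, hnorm r (X (X φ)) ≤ C1 * C2 * hnorm (r + 2) φ := fun φ => by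
      rw [mul_assoc]
      exact ((h1 _).1).trans (mul_le_mul_of_nonneg_left (h2 φ).1 hC1)
    have hD1 : ∀ φ, hnorm r (D φ) ≤ C1 * hnorm (r + 2) φ := fun φ =>
      ((h1 _).2).trans (mul_le_mul_of_nonneg_left (hnorm_le_succ (r + 1) φ) hC1)
    have h01 : ∀ φ, hnorm r φ ≤ hnorm (r + 2) φ := fun φ => hnorm_mono φ (by omega)
    refine ⟨r + 2, C * (3 * (C1 * C2) + 1 + 2 * (C1 * C1)), by positivity, fun φ ψ => ?_⟩
    rw [hnorm_succ, osc_sprod, hnorm_smul]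
    set a := hnorm (r + 2) φ with ha
    set b := hnorm (r + 2) ψ with hb
    have a0 : 0 ≤ a := hnorm_nonneg _ _
    have b0 : 0 ≤ b := hnorm_nonneg _ _
    have key : ∀ (φ' ψ' : 𝓢(ℝ, ℂ)) (K K' : ℝ), 0 ≤ K → hnorm r φ' ≤ K * a →
        hnorm r ψ' ≤ K' * b → hnorm m (sprod φ' ψ') ≤ C * (K * K') * (a * b) := by
      intro φ' ψ' K K' hK hp hq
      refine (h φ' ψ').trans ?_
      calc C * hnorm r φ' * hnorm r ψ' ≤ C * (K * a) * (K' * b) := by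
            have := hnorm_nonneg r ψ'
            gcongr
        _ = _ := by ring
    have e1 := key (X (X φ)) ψ (C1 * C2) 1 (by positivity) (hXX φ) (by simpa using h01 ψ)
    have e2 := key φ ψ 1 1 (by positivity) (by simpa using h01 φ) (by simpa using h01 ψ)
    have e3 := key (D (D φ)) ψ (C1 * C2) 1 (by positivity) (hDD φ) (by simpa using h01 ψ)
    have e4 := key (D φ) (D ψ) C1 C1 (by positivity) (hD1 φ) (hD1 ψ)
    have e5 := key φ (D (D ψ)) 1 (C1 * C2) (by positivity) (by simpa using h01 φ) (hDD ψ)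
    have t1 := hnorm_sub_le m (sprod (X (X φ)) ψ + sprod φ ψ - sprod (D (D φ)) ψ -
      (2 : ℂ) • sprod (D φ) (D ψ)) (sprod φ (D (D ψ)))
    have t2 := hnorm_sub_le m (sprod (X (X φ)) ψ + sprod φ ψ - sprod (D (D φ)) ψ)
      ((2 : ℂ) • sprod (D φ) (D ψ))
    have t3 := hnorm_sub_le m (sprod (X (X φ)) ψ + sprod φ ψ) (sprod (D (D φ)) ψ)
    have t4 := hnorm_add_le m (sprod (X (X φ)) ψ) (sprod φ ψ)
    rw [hnorm_smul] at t2
    norm_num at t2 ⊢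
    have := hnorm_nonneg m (sprod (X (X φ)) ψ + sprod φ ψ - sprod (D (D φ)) ψ -
      (2 : ℂ) • sprod (D φ) (D ψ) - sprod φ (D (D ψ)))
    nlinarith

/-! ### Hermite functions -/

/-- The pointwise formula `h_n(x) = (√(2π) n!)^{-1/2} e^{-x²/4} H_n(x)` of the Hermite functions,
with `H_n(x) = (-1)^n e^{x²/2} (d/dx)^n e^{-x²/2}` the probabilists' Hermite polynomial. -/
def hermiteFn (n : ℕ) (x : ℝ) : ℝ :=
  (√(√(2 * Real.pi) * (Nat.factorial n : ℝ)))⁻¹ * Real.exp (-(x ^ 2) / 4) *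
    Polynomial.aeval x (Polynomial.hermite n)

theorem poly_gauss_bound (P : Polynomial ℤ) (k : ℕ) : ∃ C : ℝ, ∀ x : ℝ,
    |x| ^ k * (|Polynomial.aeval x P| * Real.exp (-(x ^ 2 / 2))) ≤ C := by
  induction P using Polynomial.induction_on' with
  | add p q hp hq =>
    obtain ⟨C, hC⟩ := hp
    obtain ⟨C', hC'⟩ := hq
    refine ⟨C + C', fun x => le_trans ?_ (add_le_add (hC x) (hC' x))⟩
    rw [map_add, ← mul_add, ← add_mul]
    gcongr
    exact abs_add_le _ _
  | monomial n a =>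
    refine ⟨|(a : ℝ)| * ((Nat.factorial (k + n) : ℝ) * Real.exp (1 / 2)), fun x => ?_⟩
    have h1 := Real.pow_div_factorial_le_exp |x| (abs_nonneg x) (k + n)
    rw [div_le_iff₀ (by positivity)] at h1
    have h2 : Real.exp |x| * Real.exp (-(x ^ 2 / 2)) ≤ Real.exp (1 / 2) := by
      rw [← Real.exp_add]
      refine Real.exp_le_exp.2 ?_
      nlinarith [sq_abs x, sq_nonneg (|x| - 1)]
    have h3 : |Polynomial.aeval x (Polynomial.monomial n a)| = |(a : ℝ)| * |x| ^ n := by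
      simp [Polynomial.aeval_monomial, abs_mul]
    rw [h3]
    calc |x| ^ k * (|(a : ℝ)| * |x| ^ n * Real.exp (-(x ^ 2 / 2)))
        = |(a : ℝ)| * (|x| ^ (k + n) * Real.exp (-(x ^ 2 / 2))) := by ring
      _ ≤ |(a : ℝ)| * (Real.exp |x| * (Nat.factorial (k + n) : ℝ) * Real.exp (-(x ^ 2 / 2))) := by
        gcongr
      _ = |(a : ℝ)| * ((Nat.factorial (k + n) : ℝ) * (Real.exp |x| * Real.exp (-(x ^ 2 / 2)))) := by
        ring
      _ ≤ _ := by gcongr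

/-- The Gaussian `e^{-x²/2}` as a Schwartz function. -/
def gauss : 𝓢(ℝ, ℝ) where
  toFun y := Real.exp (-(y ^ 2 / 2))
  smooth' := by fun_prop
  decay' k n := by
    obtain ⟨C, hC⟩ := poly_gauss_bound (Polynomial.hermite n) k
    refine ⟨C, fun x => le_trans (le_of_eq ?_) (hC x)⟩
    rw [norm_iteratedFDeriv_eq_norm_iteratedDeriv, iteratedDeriv_eq_iterate,
      Polynomial.deriv_gaussian_eq_hermite_mul_gaussian]
    simp

theorem sqrt_two_inv_ne : (√2 : ℝ)⁻¹ ≠ 0 := by positivity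

theorem temperate_poly (P : Polynomial ℤ) (c : ℝ) :
    Function.HasTemperateGrowth (fun x : ℝ => ((c * Polynomial.aeval x P : ℝ) : ℂ)) := by
  induction P using Polynomial.induction_on' with
  | add p q hp hq =>
    have := hp.add hq
    simpa [mul_add, Pi.add_def] using this
  | monomial n a =>
    have : Function.HasTemperateGrowth (fun x : ℝ => ((c : ℂ) * (a : ℂ)) * (x : ℂ) ^ n) := by
      fun_prop
    simpa [Polynomial.aeval_monomial, mul_assoc] using this

theorem exists_hermite (n : ℕ) : ∃ φ : 𝓢(ℝ, ℂ), (φ : ℝ → ℂ) = fun x => (hermiteFn n x : ℂ) := by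
  refine ⟨SchwartzMap.smulLeftCLM ℂ
    (fun x : ℝ => (((√(√(2 * Real.pi) * (Nat.factorial n : ℝ)))⁻¹ *
      Polynomial.aeval x (Polynomial.hermite n) : ℝ) : ℂ))
    (dilS (√2)⁻¹ sqrt_two_inv_ne (SchwartzMap.postcompCLM Complex.ofRealCLM gauss)), ?_⟩
  ext x
  rw [SchwartzMap.smulLeftCLM_apply_apply (temperate_poly _ _), dilS_apply,
    SchwartzMap.postcompCLM_apply]
  have : gauss (x * (√2)⁻¹) = Real.exp (-(x ^ 2) / 4) := by
    change Real.exp (-((x * (√2)⁻¹) ^ 2 / 2)) = _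
    congr 1
    rw [mul_pow, inv_pow, Real.sq_sqrt (by norm_num)]; ring
  rw [this, hermiteFn, smul_eq_mul, Complex.ofRealCLM_apply, ← Complex.ofReal_mul]
  congr 1; ring

/-- The Hermite functions `h_n` as elements of the Schwartz space. -/
def hermiteS (n : ℕ) : 𝓢(ℝ, ℂ) where
  toFun x := (hermiteFn n x : ℂ)
  smooth' := by
    obtain ⟨φ, hφ⟩ := exists_hermite n
    rw [← hφ]; exact φ.smooth'
  decay' := by
    obtain ⟨φ, hφ⟩ := exists_hermite n
    rw [← hφ]; exact φ.decay'

theorem hermiteS_apply (n : ℕ) (x : ℝ) : hermiteS n x = (hermiteFn n x : ℂ) := rfl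

theorem derivative_hermite (n : ℕ) : Polynomial.derivative (Polynomial.hermite n) =
    (n : Polynomial ℤ) * Polynomial.hermite (n - 1) := by
  induction n with
  | zero => simp
  | succ n ih =>
    rw [Polynomial.hermite_succ, Polynomial.derivative_sub, Polynomial.derivative_mul, ih,
      Polynomial.derivative_mul, Polynomial.derivative_X, Polynomial.derivative_natCast]
    cases n with
    | zero => simp
    | succ n =>
      have := Polynomial.hermite_succ n
      simp only [Nat.add_sub_cancel, Nat.cast_add, Nat.cast_one] at *
      rw [this]; ring

theorem hermite_rec (n : ℕ) (x : ℝ) :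
    Polynomial.aeval x (Polynomial.hermite (n + 1)) =
      x * Polynomial.aeval x (Polynomial.hermite n) -
        n * Polynomial.aeval x (Polynomial.hermite (n - 1)) := by
  rw [Polynomial.hermite_succ, derivative_hermite]; simp

/-- The normalization constant of the Hermite functions. -/
theorem coef_succ (n : ℕ) : (√(√(2 * Real.pi) * (Nat.factorial n : ℝ)))⁻¹ =
    √(n + 1 : ℝ) * (√(√(2 * Real.pi) * (Nat.factorial (n + 1) : ℝ)))⁻¹ := by
  have h : √(2 * Real.pi) * (Nat.factorial (n + 1) : ℝ) =
      (n + 1 : ℝ) * (√(2 * Real.pi) * (Nat.factorial n : ℝ)) := by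
    rw [Nat.factorial_succ]; push_cast; ring
  rw [h, Real.sqrt_mul (by positivity : (0 : ℝ) ≤ (n : ℝ) + 1)]
  have h1 : √(n + 1 : ℝ) ≠ 0 := by positivity
  rw [mul_inv, mul_inv_cancel_left₀ h1]

theorem coef_pred (n : ℕ) (y : ℝ) :
    (√(√(2 * Real.pi) * (Nat.factorial n : ℝ)))⁻¹ * (n * y) =
    √(n : ℝ) * ((√(√(2 * Real.pi) * (Nat.factorial (n - 1) : ℝ)))⁻¹ * y) := by
  cases n with
  | zero => simp
  | succ n =>
    rw [Nat.add_sub_cancel, coef_succ n]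
    have : √(n + 1 : ℝ) * √(n + 1 : ℝ) = n + 1 := Real.mul_self_sqrt (by positivity)
    push_cast
    linear_combination (-(√(√(2 * Real.pi) * (Nat.factorial (n + 1) : ℝ)))⁻¹ * y) * this

theorem x_hermiteFn (n : ℕ) (x : ℝ) : x * hermiteFn n x =
    √(n + 1 : ℝ) * hermiteFn (n + 1) x + √(n : ℝ) * hermiteFn (n - 1) x := by
  have h1 := hermite_rec n x
  have h2 := coef_succ n
  have h3 := coef_pred n (Polynomial.aeval x (Polynomial.hermite (n - 1)))
  unfold hermiteFn
  rw [h1]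
  linear_combination (Real.exp (-(x ^ 2) / 4)) * h3 + Real.exp (-(x ^ 2) / 4) *
    (x * Polynomial.aeval x (Polynomial.hermite n) -
        n * Polynomial.aeval x (Polynomial.hermite (n - 1))) * h2

theorem deriv_hermiteFn (n : ℕ) (x : ℝ) : HasDerivAt (hermiteFn n)
    ((1 / 2) * (√(n : ℝ) * hermiteFn (n - 1) x - √(n + 1 : ℝ) * hermiteFn (n + 1) x)) x := by
  have h1 : HasDerivAt (fun y : ℝ => -(y ^ 2) / 4) (-(2 * x) / 4) x := by
    have := ((hasDerivAt_pow 2 x).neg.div_const 4)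
    simpa using this
  have h2 := Polynomial.hasDerivAt_aeval (Polynomial.hermite n) x
  have h3 := (h1.exp.const_mul (√(√(2 * Real.pi) * (Nat.factorial n : ℝ)))⁻¹).mul h2
  refine h3.congr_deriv ?_
  have e1 := x_hermiteFn n x
  have e3 := coef_pred n (Polynomial.aeval x (Polynomial.hermite (n - 1)))
  rw [derivative_hermite]
  unfold hermiteFn at *
  simp only [map_mul, map_natCast]
  linear_combination (-1 / 2) * e1 + Real.exp (-(x ^ 2) / 4) * e3

theorem X_hermiteS (n : ℕ) : X (hermiteS n) =
    ((√(n + 1 : ℝ) : ℝ) : ℂ) • hermiteS (n + 1) + ((√(n : ℝ) : ℝ) : ℂ) • hermiteS (n - 1) := by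
  ext x
  simp only [X_apply, hermiteS_apply, add_apply, smul_apply, smul_eq_mul]
  exact_mod_cast x_hermiteFn n x

theorem D_hermiteS (n : ℕ) : D (hermiteS n) = (1 / 2 : ℂ) •
    (((√(n : ℝ) : ℝ) : ℂ) • hermiteS (n - 1) - ((√(n + 1 : ℝ) : ℝ) : ℂ) • hermiteS (n + 1)) := by
  ext x
  have h : HasDerivAt (hermiteS n : ℝ → ℂ) _ x := (deriv_hermiteFn n x).ofReal_comp
  rw [D_apply, h.deriv]
  simp [hermiteS_apply]

theorem norm_hermiteS_succ (n : ℕ) : ‖L2 (hermiteS (n + 1))‖ = ‖L2 (hermiteS n)‖ := by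
  have hs : ((√(n + 1 : ℝ) : ℝ) : ℂ) ≠ 0 := by
    have : √(n + 1 : ℝ) ≠ 0 := by positivity
    exact_mod_cast this
  have hB : (1 / 2 : ℂ) • X (hermiteS n) - D (hermiteS n) =
      ((√(n + 1 : ℝ) : ℝ) : ℂ) • hermiteS (n + 1) := by
    rw [X_hermiteS, D_hermiteS]; module
  have hA : (1 / 2 : ℂ) • X (hermiteS (n + 1)) + D (hermiteS (n + 1)) =
      ((√(n + 1 : ℝ) : ℝ) : ℂ) • hermiteS n := by
    rw [X_hermiteS, D_hermiteS, Nat.add_sub_cancel]; push_cast; module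
  have h : ((√(n + 1 : ℝ) : ℝ) : ℂ) * inner ℂ (L2 (hermiteS (n + 1))) (L2 (hermiteS (n + 1))) =
      ((√(n + 1 : ℝ) : ℝ) : ℂ) * inner ℂ (L2 (hermiteS n)) (L2 (hermiteS n)) := by
    rw [← inner_smul_right (L2 (hermiteS n)), ← map_smul, ← hA, map_add, inner_add_right, map_smul,
      inner_smul_right, ← inner_X]
    have e : ((√(n + 1 : ℝ) : ℝ) : ℂ) * inner ℂ (L2 (hermiteS (n + 1))) (L2 (hermiteS (n + 1))) =
        inner ℂ (L2 (((√(n + 1 : ℝ) : ℝ) : ℂ) • hermiteS (n + 1))) (L2 (hermiteS (n + 1))) := by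
      rw [map_smul, inner_smul_left, Complex.conj_ofReal]
    rw [e, ← hB, map_sub, inner_sub_left, inner_D, map_smul, inner_smul_left]
    have h2 : (starRingEnd ℂ) (1 / 2 : ℂ) = 1 / 2 := by simp [Complex.conj_ofNat]
    rw [h2, sub_neg_eq_add]
  have h' := mul_left_cancel₀ hs h
  rw [inner_self_eq_norm_sq_to_K, inner_self_eq_norm_sq_to_K] at h'
  have h2 : ‖L2 (hermiteS (n + 1))‖ ^ 2 = ‖L2 (hermiteS n)‖ ^ 2 := by exact_mod_cast h'
  exact (sq_eq_sq₀ (norm_nonneg _) (norm_nonneg _)).1 h2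

/-- A linear operator whose values on the Hermite functions grow at most polynomially in `L²`. -/
def PolyOn (A : 𝓢(ℝ, ℂ) →L[ℂ] 𝓢(ℝ, ℂ)) : Prop :=
  ∃ (C : ℝ) (p : ℕ), 0 ≤ C ∧ ∀ n : ℕ, ‖L2 (A (hermiteS n))‖ ≤ C * ((n : ℝ) + 1) ^ p

theorem sqrt_le_add_one (a : ℝ) (ha : 0 ≤ a) : √a ≤ a + 1 := by
  rw [Real.sqrt_le_left (by positivity)]; nlinarith

theorem PolyOn.pair {A : 𝓢(ℝ, ℂ) →L[ℂ] 𝓢(ℝ, ℂ)} (hA : PolyOn A) :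
    ∃ (C : ℝ) (p : ℕ), 0 ≤ C ∧ ∀ n : ℕ,
      √(n + 1 : ℝ) * ‖L2 (A (hermiteS (n + 1)))‖ + √(n : ℝ) * ‖L2 (A (hermiteS (n - 1)))‖ ≤
        C * ((n : ℝ) + 1) ^ p := by
  obtain ⟨C, p, hC, h⟩ := hA
  refine ⟨2 * (C * 2 ^ p) + C, p + 1, by positivity, fun n => ?_⟩
  have h1 := h (n + 1)
  have h2 := h (n - 1)
  have hn : (0 : ℝ) ≤ n := Nat.cast_nonneg n
  have e1 : C * (((n + 1 : ℕ) : ℝ) + 1) ^ p ≤ C * 2 ^ p * ((n : ℝ) + 1) ^ p := by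
    rw [mul_assoc, ← mul_pow]
    gcongr; push_cast; linarith
  have e2 : C * (((n - 1 : ℕ) : ℝ) + 1) ^ p ≤ C * ((n : ℝ) + 1) ^ p := by
    gcongr; exact Nat.sub_le _ _
  have s1 : √(n + 1 : ℝ) ≤ 2 * ((n : ℝ) + 1) := by
    have := sqrt_le_add_one ((n : ℝ) + 1) (by positivity); linarith
  have s2 := sqrt_le_add_one (n : ℝ) hn
  calc _ ≤ 2 * ((n : ℝ) + 1) * (C * 2 ^ p * ((n : ℝ) + 1) ^ p) +
        ((n : ℝ) + 1) * (C * ((n : ℝ) + 1) ^ p) := by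
        gcongr
        · exact h1.trans e1
        · exact h2.trans e2
    _ = _ := by ring

theorem PolyOn.comp_X {A : 𝓢(ℝ, ℂ) →L[ℂ] 𝓢(ℝ, ℂ)} (hA : PolyOn A) : PolyOn (A ∘L X) := by
  obtain ⟨C, p, hC, h⟩ := hA.pair
  refine ⟨C, p, hC, fun n => le_trans ?_ (h n)⟩
  simp only [ContinuousLinearMap.comp_apply, X_hermiteS, map_add, map_smul]
  refine (norm_add_le _ _).trans (le_of_eq ?_)
  simp only [norm_smul, Complex.norm_real, Real.norm_eq_abs, abs_of_nonneg (Real.sqrt_nonneg _)]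

theorem PolyOn.comp_D {A : 𝓢(ℝ, ℂ) →L[ℂ] 𝓢(ℝ, ℂ)} (hA : PolyOn A) : PolyOn (A ∘L D) := by
  obtain ⟨C, p, hC, h⟩ := hA.pair
  refine ⟨C, p, hC, fun n => le_trans ?_ (h n)⟩
  have hc : ‖(1 / 2 : ℂ)‖ = 1 / 2 := by norm_num
  simp only [ContinuousLinearMap.comp_apply, D_hermiteS, map_sub, map_smul]
  rw [norm_smul, hc]
  have h1 := norm_sub_le (((√(n : ℝ) : ℝ) : ℂ) • L2 (A (hermiteS (n - 1))))
    (((√(n + 1 : ℝ) : ℝ) : ℂ) • L2 (A (hermiteS (n + 1))))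
  simp only [norm_smul, Complex.norm_real, Real.norm_eq_abs,
    abs_of_nonneg (Real.sqrt_nonneg _)] at h1
  have h2 : 0 ≤ √(n : ℝ) * ‖L2 (A (hermiteS (n - 1)))‖ := by positivity
  have h3 : 0 ≤ √(n + 1 : ℝ) * ‖L2 (A (hermiteS (n + 1)))‖ := by positivity
  linarith

theorem PolyOn.add {A B : 𝓢(ℝ, ℂ) →L[ℂ] 𝓢(ℝ, ℂ)} (hA : PolyOn A) (hB : PolyOn B) :
    PolyOn (A + B) := by
  obtain ⟨C, p, hC, h⟩ := hA
  obtain ⟨C', p', hC', h'⟩ := hB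
  refine ⟨C + C', max p p', by positivity, fun n => ?_⟩
  have h1 : (1 : ℝ) ≤ (n : ℝ) + 1 := by linarith [Nat.cast_nonneg (α := ℝ) n]
  calc _ ≤ ‖L2 (A (hermiteS n))‖ + ‖L2 (B (hermiteS n))‖ := by
        rw [add_apply, map_add]; exact norm_add_le _ _
    _ ≤ C * ((n : ℝ) + 1) ^ p + C' * ((n : ℝ) + 1) ^ p' := add_le_add (h n) (h' n)
    _ ≤ C * ((n : ℝ) + 1) ^ max p p' + C' * ((n : ℝ) + 1) ^ max p p' := by
      gcongr <;> first | exact h1 | exact le_max_left _ _ | exact le_max_right _ _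
    _ = _ := by ring

theorem PolyOn.smul {A : 𝓢(ℝ, ℂ) →L[ℂ] 𝓢(ℝ, ℂ)} (hA : PolyOn A) (c : ℂ) : PolyOn (c • A) := by
  obtain ⟨C, p, hC, h⟩ := hA
  refine ⟨‖c‖ * C, p, by positivity, fun n => ?_⟩
  rw [smul_apply, map_smul, norm_smul, mul_assoc]
  exact mul_le_mul_of_nonneg_left (h n) (norm_nonneg _)

theorem polyOn_osc_pow (m : ℕ) : PolyOn (osc ^ m) := by
  induction m with
  | zero =>
    refine ⟨‖L2 (hermiteS 0)‖, 0, norm_nonneg _, fun n => ?_⟩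
    have : ‖L2 (hermiteS n)‖ = ‖L2 (hermiteS 0)‖ := by
      induction n with
      | zero => rfl
      | succ n ih => rw [norm_hermiteS_succ, ih]
    simpa using this.le
  | succ m ih =>
    have h := (((ih.comp_D.comp_D.smul (-1)).add ih.comp_X.comp_X).add ih).smul (1 / 2)
    convert h using 1
    ext1 φ
    rw [pow_succ]
    change (osc ^ m) (osc φ) = (1 / 2 : ℂ) • ((-1 : ℂ) • (osc ^ m) (D (D φ)) +
      (osc ^ m) (X (X φ)) + (osc ^ m) φ)
    rw [osc_eq, map_smul, map_add, map_add, map_neg, neg_one_smul]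

theorem hnorm_hermiteS (m : ℕ) : ∃ (C : ℝ) (p : ℕ), 0 ≤ C ∧ ∀ n : ℕ,
    hnorm m (hermiteS n) ≤ C * ((n : ℝ) + 1) ^ p := by
  obtain ⟨C, p, hC, h⟩ := polyOn_osc_pow m
  exact ⟨C, p, hC, fun n => (hnorm_eq m _).le.trans (h n)⟩

/-! ### The tempered algebra -/

/-- Membership in `s`: the sequence is rapidly decreasing. -/
def IsRapid (a : ℕ → ℝ) : Prop :=
  ∀ m : ℕ, Summable fun n : ℕ => ((n : ℝ) + 1) ^ (2 * m) * |a n| ^ 2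

/-- Membership in `s'`: the sequence grows at most polynomially. -/
def IsTempered (a : ℕ → ℝ) : Prop :=
  ∃ (C : ℝ) (m : ℕ), ∀ n : ℕ, |a n| ≤ C * ((n : ℝ) + 1) ^ m

theorem IsRapid.mono {a b : ℕ → ℝ} (hb : IsRapid b) (h : ∀ n, |a n| ≤ |b n|) : IsRapid a :=
  fun m => (hb m).of_nonneg_of_le (fun n => by positivity) fun n =>
    mul_le_mul_of_nonneg_left (pow_le_pow_left₀ (abs_nonneg _) (h n) 2) (by positivity)

theorem IsRapid.add {a b : ℕ → ℝ} (ha : IsRapid a) (hb : IsRapid b) :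
    IsRapid fun n => a n + b n := fun m => by
  refine (((ha m).add (hb m)).mul_left 2).of_nonneg_of_le (fun n => by positivity) fun n => ?_
  have h : |a n + b n| ^ 2 ≤ 2 * (|a n| ^ 2 + |b n| ^ 2) := by
    simp only [sq_abs]; nlinarith [sq_nonneg (a n - b n)]
  have := mul_le_mul_of_nonneg_left h (by positivity : 0 ≤ ((n : ℝ) + 1) ^ (2 * m))
  linarith

theorem IsRapid.mul {a b : ℕ → ℝ} (ha : IsTempered a) (hb : IsRapid b) :
    IsRapid fun n => a n * b n := fun m => by
  obtain ⟨C, p, h⟩ := ha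
  refine ((hb (m + p)).mul_left (C ^ 2)).of_nonneg_of_le (fun n => by positivity) fun n => ?_
  have h1 : |a n| ^ 2 ≤ (C * ((n : ℝ) + 1) ^ p) ^ 2 := by gcongr; exact h n
  calc _ = ((n : ℝ) + 1) ^ (2 * m) * (|a n| ^ 2 * |b n| ^ 2) := by rw [abs_mul, mul_pow]
    _ ≤ ((n : ℝ) + 1) ^ (2 * m) * ((C * ((n : ℝ) + 1) ^ p) ^ 2 * |b n| ^ 2) := by gcongr
    _ = _ := by ring

theorem isTempered_const (c : ℝ) : IsTempered fun _ => c := ⟨|c|, 0, fun n => by simp⟩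

theorem IsTempered.mono {a b : ℕ → ℝ} (hb : IsTempered b) (h : ∀ n, |a n| ≤ |b n|) :
    IsTempered a := by
  obtain ⟨C, p, h'⟩ := hb
  exact ⟨C, p, fun n => (h n).trans (h' n)⟩

theorem IsTempered.bound {a : ℕ → ℝ} (ha : IsTempered a) : ∃ (C : ℝ) (m : ℕ), 0 ≤ C ∧
    ∀ q : ℕ, m ≤ q → ∀ n : ℕ, |a n| ≤ C * ((n : ℝ) + 1) ^ q := by
  obtain ⟨C, p, h⟩ := ha
  have hC : 0 ≤ C := by simpa using (abs_nonneg _).trans (h 0)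
  refine ⟨C, p, hC, fun q hq n => (h n).trans ?_⟩
  have h1 : (1 : ℝ) ≤ (n : ℝ) + 1 := by linarith [Nat.cast_nonneg (α := ℝ) n]
  gcongr

theorem IsTempered.add {a b : ℕ → ℝ} (ha : IsTempered a) (hb : IsTempered b) :
    IsTempered fun n => a n + b n := by
  obtain ⟨C, p, -, h⟩ := ha.bound
  obtain ⟨C', p', -, h'⟩ := hb.bound
  refine ⟨C + C', max p p', fun n => (abs_add_le _ _).trans ?_⟩
  rw [add_mul]
  exact add_le_add (h _ (le_max_left _ _) n) (h' _ (le_max_right _ _) n)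

theorem IsTempered.mul {a b : ℕ → ℝ} (ha : IsTempered a) (hb : IsTempered b) :
    IsTempered fun n => a n * b n := by
  obtain ⟨C, p, hC, h⟩ := ha.bound
  obtain ⟨C', p', -, h'⟩ := hb.bound
  refine ⟨C * C', p + p', fun n => ?_⟩
  rw [abs_mul]
  calc _ ≤ (C * ((n : ℝ) + 1) ^ p) * (C' * ((n : ℝ) + 1) ^ p') := by
        gcongr
        · exact h _ le_rfl n
        · exact h' _ le_rfl n
    _ = _ := by ring

/-- `H_{s'}`: the sequences of Schwartz functions all of whose norms grow at most polynomially. -/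
def Hs' : Submodule ℂ (ℕ → 𝓢(ℝ, ℂ)) where
  carrier := {f | ∀ m : ℕ, IsTempered fun n => hnorm m (f n)}
  zero_mem' m := by simpa [hnorm_zero_right] using isTempered_const 0
  add_mem' {f g} hf hg m := ((hf m).add (hg m)).mono fun n => by
    rw [abs_of_nonneg (hnorm_nonneg _ _)]
    exact (hnorm_add_le m (f n) (g n)).trans (le_abs_self _)
  smul_mem' c f hf m := ((isTempered_const ‖c‖).mul (hf m)).mono fun n => by
    rw [Pi.smul_apply, hnorm_smul]

/-- `H_s`: the sequences of Schwartz functions all of whose norms are rapidly decreasing. -/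
def Hs : Submodule ℂ (ℕ → 𝓢(ℝ, ℂ)) where
  carrier := {f | ∀ m : ℕ, IsRapid fun n => hnorm m (f n)}
  zero_mem' m := by
    intro l
    simp [hnorm_zero_right, summable_zero]
  add_mem' {f g} hf hg m := ((hf m).add (hg m)).mono fun n => by
    rw [abs_of_nonneg (hnorm_nonneg _ _)]
    exact (hnorm_add_le m (f n) (g n)).trans (le_abs_self _)
  smul_mem' c f hf m := (IsRapid.mul (isTempered_const ‖c‖) (hf m)).mono fun n => by
    rw [Pi.smul_apply, hnorm_smul]

/-- The tempered algebra `H = H_{s'} / H_s` of tempered generalized functions. -/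
abbrev H : Type := Hs' ⧸ (Hs.comap Hs'.subtype)

/-- The class `[f_n]` of a sequence in `H_{s'}`. -/
def cls (f : Hs') : H := (Hs.comap Hs'.subtype).mkQ f

/-- A continuous linear operator on the Schwartz space applied term by term on `H_{s'}`. -/
def mapSeq (A : 𝓢(ℝ, ℂ) →L[ℂ] 𝓢(ℝ, ℂ)) : Hs' →ₗ[ℂ] Hs' where
  toFun f := ⟨fun n => A (f.1 n), fun m => by
    obtain ⟨r, C, hC, h⟩ := map_bound A m
    refine ((isTempered_const C).mul (f.2 r)).mono fun n => ?_
    rw [abs_of_nonneg (hnorm_nonneg _ _)]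
    exact (h _).trans (le_abs_self _)⟩
  map_add' f g := by ext1; funext n; simp
  map_smul' c f := by ext1; funext n; simp

theorem mapSeq_mem (A : 𝓢(ℝ, ℂ) →L[ℂ] 𝓢(ℝ, ℂ)) :
    Hs.comap Hs'.subtype ≤ (Hs.comap Hs'.subtype).comap (mapSeq A) := fun f hf m => by
  obtain ⟨r, C, hC, h⟩ := map_bound A m
  refine (IsRapid.mul (isTempered_const C) (hf r)).mono fun n => ?_
  rw [abs_of_nonneg (hnorm_nonneg _ _)]
  exact (h _).trans (le_abs_self _)

/-- The operator `[f_n] ↦ [A f_n]` on `H` induced by a continuous linear operator `A` on the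
Schwartz space. -/
def mapH (A : 𝓢(ℝ, ℂ) →L[ℂ] 𝓢(ℝ, ℂ)) : H →ₗ[ℂ] H :=
  Submodule.mapQ _ _ (mapSeq A) (mapSeq_mem A)

/-- The derivative `D[f_n] = [D f_n]` on `H`. -/
def DH : H →ₗ[ℂ] H := mapH D

/-- The Fourier transform `F([f_n]) = [F(f_n)]`, a linear automorphism of `H`. -/
def fourierH : H ≃ₗ[ℂ] H :=
  LinearEquiv.ofLinearMap (mapH fourierS) (mapH fourierS.symm)
    (by
      ext f
      change cls (mapSeq _ (mapSeq _ f)) = cls f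
      congr 1; ext1; funext n
      exact fourierS.apply_symm_apply _)
    (by
      ext f
      change cls (mapSeq _ (mapSeq _ f)) = cls f
      congr 1; ext1; funext n
      exact fourierS.symm_apply_apply _)

/-- The term by term product of sequences in `H_{s'}`. -/
def mulSeq (f g : Hs') : Hs' := ⟨fun n => sprod (f.1 n) (g.1 n), fun m => by
  obtain ⟨r, C, hC, h⟩ := sprod_bound m
  refine (((isTempered_const C).mul (f.2 r)).mul (g.2 r)).mono fun n => ?_
  rw [abs_of_nonneg (hnorm_nonneg _ _)]
  exact (h _ _).trans (le_abs_self _)⟩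

theorem cls_eq_iff (f g : Hs') : cls f = cls g ↔ f.1 - g.1 ∈ Hs :=
  Submodule.Quotient.eq _

theorem mulSeq_congr {f f' g g' : Hs'} (hf : cls f = cls f') (hg : cls g = cls g') :
    cls (mulSeq f g) = cls (mulSeq f' g') := by
  rw [cls_eq_iff] at *
  intro m
  obtain ⟨r, C, hC, h⟩ := sprod_bound m
  refine ((IsRapid.mul ((isTempered_const C).mul (f.2 r)) (hg r)).add
    (IsRapid.mul ((isTempered_const C).mul (g'.2 r)) (hf r))).mono fun n => ?_
  rw [abs_of_nonneg (hnorm_nonneg _ _)]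
  refine le_trans ?_ (le_abs_self _)
  have e : (mulSeq f g).1 n - (mulSeq f' g').1 n =
      sprod (f.1 n) ((g.1 - g'.1) n) + sprod ((f.1 - f'.1) n) (g'.1 n) := by
    ext x
    change f.1 n x * g.1 n x - f'.1 n x * g'.1 n x =
      f.1 n x * (g.1 n x - g'.1 n x) + (f.1 n x - f'.1 n x) * g'.1 n x
    ring
  have h1 := h (f.1 n) ((g.1 - g'.1) n)
  have h2 := h ((f.1 - f'.1) n) (g'.1 n)
  have h3 := hnorm_add_le m (sprod (f.1 n) ((g.1 - g'.1) n)) (sprod ((f.1 - f'.1) n) (g'.1 n))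
  rw [Pi.sub_apply, e]
  linarith

/-- The product `[f_n] · [g_n] = [f_n g_n]` on `H`. -/
instance : Mul H where
  mul := Quotient.map₂ mulSeq fun _ _ hf _ _ hg =>
    Quotient.exact (mulSeq_congr (Quotient.sound hf) (Quotient.sound hg))

theorem cls_mul (f g : Hs') : cls f * cls g = cls (mulSeq f g) := rfl

/-- The convolution `u ∗ v = F⁻¹(√(2π) F(u) · F(v))` on `H`. -/
def convH (u v : H) : H :=
  fourierH.symm (((√(2 * Real.pi) : ℝ) : ℂ) • (fourierH u * fourierH v))

/-- Association of tempered generalized functions: `u ≈ v` if the pairings `⟨f_n - g_n, φ⟩` tend to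
`0` for all Schwartz functions `φ`, where `u = [f_n]` and `v = [g_n]`. -/
def Assoc (u v : H) : Prop :=
  ∀ f g : Hs', cls f = u → cls g = v → ∀ φ : 𝓢(ℝ, ℂ),
    Tendsto (fun n => ∫ x : ℝ, (f.1 n x - g.1 n x) * φ x) atTop (𝓝 0)

/-- The partial sums `T_n = ∑_{j ≤ n} T(h_j) h_j` of the Hermite series of `T`. -/
def partialSum (T : 𝓢'(ℝ, ℂ)) (n : ℕ) : 𝓢(ℝ, ℂ) :=
  ∑ j ∈ Finset.range (n + 1), T (hermiteS j) • hermiteS j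

theorem partialSum_mem (T : 𝓢'(ℝ, ℂ)) : partialSum T ∈ Hs' := fun m => by
  obtain ⟨r, C, hC, hT⟩ := functional_bound T
  obtain ⟨K, p, hK, h⟩ := hnorm_hermiteS r
  obtain ⟨K', p', hK', h'⟩ := hnorm_hermiteS m
  refine ⟨C * K * K', p + p' + 1, fun n => ?_⟩
  rw [abs_of_nonneg (hnorm_nonneg _ _)]
  have hsum : ∀ s : Finset ℕ, hnorm m (∑ j ∈ s, T (hermiteS j) • hermiteS j) ≤
      ∑ j ∈ s, ‖T (hermiteS j)‖ * hnorm m (hermiteS j) := fun s => by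
    simp only [hnorm_eq, map_sum, map_smul]
    refine (norm_sum_le _ _).trans (le_of_eq ?_)
    simp only [norm_smul]
  refine (hsum _).trans ?_
  have : ∀ j ∈ Finset.range (n + 1), ‖T (hermiteS j)‖ * hnorm m (hermiteS j) ≤
      C * (K * ((n : ℝ) + 1) ^ p) * (K' * ((n : ℝ) + 1) ^ p') := fun j hj => by
    have hj' : (j : ℝ) ≤ n := by exact_mod_cast Nat.lt_succ_iff.1 (Finset.mem_range.1 hj)
    have := hnorm_nonneg m (hermiteS j)
    gcongr
    · refine (hT _).trans (mul_le_mul_of_nonneg_left ((h j).trans ?_) hC)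
      gcongr
    · refine (h' j).trans ?_
      gcongr
  refine (Finset.sum_le_card_nsmul _ _ _ this).trans (le_of_eq ?_)
  simp only [Finset.card_range, nsmul_eq_mul]
  push_cast; ring

/-- The embedding `ι(T) = [T_n]` of the tempered distributions in `H`. -/
def iota (T : 𝓢'(ℝ, ℂ)) : H := cls ⟨partialSum T, partialSum_mem T⟩

/-- The reflection `φ̃(x) = φ(-x)` on the Schwartz space. -/
def reflS : 𝓢(ℝ, ℂ) →L[ℂ] 𝓢(ℝ, ℂ) :=
  SchwartzMap.compCLMOfContinuousLinearEquiv ℂ (ContinuousLinearEquiv.neg ℝ)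

theorem reflS_apply (φ : 𝓢(ℝ, ℂ)) (x : ℝ) : reflS φ x = φ (-x) := rfl

/-- The convolution of a tempered distribution and a Schwartz function, the tempered distribution
`(T ∗ φ)(ψ) = T(φ̃ ∗ ψ)`. -/
def convDist (T : 𝓢'(ℝ, ℂ)) (φ : 𝓢(ℝ, ℂ)) : 𝓢'(ℝ, ℂ) :=
  PointwiseConvergenceCLM.precomp ℂ
    (SchwartzMap.convolution (ContinuousLinearMap.mul ℂ ℂ) (reflS φ)) T

theorem convDist_apply (T : 𝓢'(ℝ, ℂ)) (φ ψ : 𝓢(ℝ, ℂ)) :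
    convDist T φ ψ = T (sconv (reflS φ) ψ) := rfl

end TGF

end

open MeasureTheory Filter Topology
open scoped SchwartzMap

noncomputable section

namespace TGF

/-! Everything algebraic rests on one identity in the Schwartz space, `fourierS_sconv`: `F(φ ∗ ψ) =
√(2π) F(φ) F(ψ)`. Applied term by term, it identifies the convolution of classes, which is defined
through `F⁻¹`, with the class of the convolutions (`convH_cls`). Since `F` is injective,
commutativity, associativity and `D(φ ∗ ψ) = Dφ ∗ ψ` follow on the Schwartz space from properties of
the pointwise product, and they pass to classes through representatives. One exchange formula is the
definition of `convH`; the other follows from it because `F²` is the reflection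
(`fourierS_fourierS`), which is multiplicative.

The association is analytic. Let `P_n` be the projection on the first `n + 1` Hermite functions.
Then `φ` is represented by `P_n φ`, and `∫ T_n χ = T(P_n χ)`. Moving the convolution to the test
function gives `∫ (T_n ∗ P_n φ) ψ = T(P_n χ_n)` with `χ_n = (P_n φ)~ ∗ ψ`. Here `n` occurs in the
projection and in its argument, so the limit `T(φ̃ ∗ ψ)` requires both that `P_n χ → χ` in the
Schwartz space and that the `P_n` are equicontinuous there.

The operator `osc` that defines the norms is not diagonal in these Hermite functions: they are
eigenfunctions of `-d²/dx² + x²/4`, not of `-d²/dx² + x²`. A second operator, `number`, has them as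
eigenfunctions. Its symmetry and continuity make Hermite coefficients decay faster than any power,
which gives equicontinuity (`hnorm_hermiteProj_le`). Completeness of the Hermite functions gives
convergence in `L²`, and the interpolation inequality `hnorm_sq_le` raises it to convergence in
every norm. -/

/-! ### Fourier transform, product and convolution of Schwartz functions -/

theorem fourierS_apply_eq (φ : 𝓢(ℝ, ℂ)) (t : ℝ) : fourierS φ t =
    ((√(2 * Real.pi) : ℝ) : ℂ)⁻¹ * (FourierTransform.fourier φ : 𝓢(ℝ, ℂ)) (t * (2 * Real.pi)⁻¹) :=
  rfl

theorem sqrt_two_pi_ne : ((√(2 * Real.pi) : ℝ) : ℂ) ≠ 0 :=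
  fun h => sqrt_two_pi_inv_ne (by rw [h, inv_zero])

/-- The Fourier transform turns convolutions into products. -/
theorem fourierS_sconv (φ ψ : 𝓢(ℝ, ℂ)) : fourierS (sconv φ ψ) =
    ((√(2 * Real.pi) : ℝ) : ℂ) • sprod (fourierS φ) (fourierS ψ) := by
  ext t
  have h : ((√(2 * Real.pi) : ℝ) : ℂ) ≠ 0 := sqrt_two_pi_ne
  rw [smul_apply, sprod_apply, smul_eq_mul]
  simp only [fourierS_apply_eq]
  rw [sconv, SchwartzMap.fourier_convolution, SchwartzMap.pairing_apply_apply,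
    ContinuousLinearMap.mul_apply']
  field_simp

theorem sprod_comm (φ ψ : 𝓢(ℝ, ℂ)) : sprod φ ψ = sprod ψ φ := by
  ext x; simp only [sprod_apply]; ring

theorem sprod_assoc (φ ψ χ : 𝓢(ℝ, ℂ)) : sprod (sprod φ ψ) χ = sprod φ (sprod ψ χ) := by
  ext x; simp only [sprod_apply]; ring

theorem sprod_smul_left (c : ℂ) (φ ψ : 𝓢(ℝ, ℂ)) : sprod (c • φ) ψ = c • sprod φ ψ := by
  ext x; simp only [sprod_apply, smul_apply, smul_eq_mul]; ring

/-- On the Fourier side this is commutativity of the pointwise product. Associativity and the rule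
for derivatives below are proved in the same way. -/
theorem sconv_comm (φ ψ : 𝓢(ℝ, ℂ)) : sconv φ ψ = sconv ψ φ := by
  apply fourierS.injective
  rw [fourierS_sconv, fourierS_sconv, sprod_comm]

theorem sconv_assoc (φ ψ χ : 𝓢(ℝ, ℂ)) : sconv (sconv φ ψ) χ = sconv φ (sconv ψ χ) := by
  apply fourierS.injective
  simp only [fourierS_sconv, sprod_smul_left, sprod_assoc]
  rw [sprod_comm _ (_ • _), sprod_smul_left, sprod_comm _ (fourierS φ)]

/-- The Fourier transform turns the derivative into the multiplication by `i t`. -/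
theorem fourierS_D (φ : 𝓢(ℝ, ℂ)) : fourierS (D φ) = Complex.I • X (fourierS φ) := by
  ext t
  have h := Real.fourier_deriv φ.integrable φ.differentiable (D φ).integrable
  -- At the ordinary frequency `t / (2π)`, the factor `2πi · t / (2π)` of the derivative becomes `i
  -- t`.
  have h' := congrFun h (t * (2 * Real.pi)⁻¹)
  rw [smul_apply, X_apply, fourierS_apply_eq, fourierS_apply_eq, SchwartzMap.fourier_coe,
    SchwartzMap.fourier_coe]
  change _ * FourierTransform.fourier (deriv φ) _ = _
  rw [h', smul_eq_mul, smul_eq_mul]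
  have : (Real.pi : ℂ) ≠ 0 := by exact_mod_cast Real.pi_ne_zero
  push_cast
  field_simp

theorem D_sconv (φ ψ : 𝓢(ℝ, ℂ)) : D (sconv φ ψ) = sconv (D φ) ψ := by
  apply fourierS.injective
  rw [fourierS_D, fourierS_sconv, fourierS_sconv, fourierS_D]
  ext x
  simp only [smul_apply, X_apply, sprod_apply, smul_eq_mul]
  ring

/-! ### Convolution of classes -/

/-- The term by term convolution of sequences in `Hs'` is in `Hs'`. -/
theorem sconv_mem (f g : Hs') : (fun n => sconv (f.1 n) (g.1 n)) ∈ Hs' := by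
  -- Each convolution is `F⁻¹` of `√(2π)` times a product of Fourier transforms, and `Hs'` is stable
  -- under products and under continuous operators; no separate estimate is needed.
  have h := (mapSeq fourierS.symm (((√(2 * Real.pi) : ℝ) : ℂ) •
    mulSeq (mapSeq fourierS f) (mapSeq fourierS g))).2
  convert h using 1
  funext n
  apply fourierS.injective
  rw [fourierS_sconv]
  exact (fourierS.apply_symm_apply _).symm

/-- The convolution of classes is the class of the term by term convolution. -/
theorem convH_cls (f g : Hs') : convH (cls f) (cls g) =
    cls ⟨fun n => sconv (f.1 n) (g.1 n), sconv_mem f g⟩ := by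
  apply fourierH.injective
  rw [convH, LinearEquiv.apply_symm_apply]
  change cls (((√(2 * Real.pi) : ℝ) : ℂ) • mulSeq (mapSeq fourierS f) (mapSeq fourierS g)) =
    cls (mapSeq fourierS _)
  congr 1
  ext1; funext n
  exact (fourierS_sconv _ _).symm

theorem cls_surjective : Function.Surjective cls := Submodule.mkQ_surjective _

theorem convH_comm (u v : H) : convH u v = convH v u := by
  obtain ⟨f, rfl⟩ := cls_surjective u
  obtain ⟨g, rfl⟩ := cls_surjective v
  simp only [convH_cls, sconv_comm]

theorem convH_assoc (u v w : H) : convH (convH u v) w = convH u (convH v w) := by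
  obtain ⟨f, rfl⟩ := cls_surjective u
  obtain ⟨g, rfl⟩ := cls_surjective v
  obtain ⟨k, rfl⟩ := cls_surjective w
  simp only [convH_cls, sconv_assoc]

theorem DH_convH (u v : H) : DH (convH u v) = convH (DH u) v := by
  obtain ⟨f, rfl⟩ := cls_surjective u
  obtain ⟨g, rfl⟩ := cls_surjective v
  have h : ∀ f, DH (cls f) = cls (mapSeq D f) := fun _ => rfl
  rw [h, convH_cls, convH_cls, h]
  congr 1
  ext1; funext n
  exact D_sconv _ _

theorem DH_iterate_convH (u v : H) (α : ℕ) : DH^[α] (convH u v) = convH (DH^[α] u) v := by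
  induction α with
  | zero => rfl
  | succ α ih => rw [Function.iterate_succ_apply', ih, DH_convH, Function.iterate_succ_apply']

theorem fourierH_convH (u v : H) : fourierH (convH u v) =
    ((√(2 * Real.pi) : ℝ) : ℂ) • (fourierH u * fourierH v) := by
  rw [convH, LinearEquiv.apply_symm_apply]

/-! ### Reflection, the exchange formula for products, and the adjoint of a convolution -/

/-- Fourier inversion at `-t`: the kernel `e^{-itx}` is the kernel of the inverse transform with the
sign of `t` changed. -/
theorem fourierS_fourierS (φ : 𝓢(ℝ, ℂ)) : fourierS (fourierS φ) = reflS φ := by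
  ext t
  have hs : ((√(2 * Real.pi) : ℝ) : ℂ) ^ 2 = 2 * Real.pi := by
    rw [← Complex.ofReal_pow, Real.sq_sqrt (by positivity)]; push_cast; rfl
  have hs0 := sqrt_two_pi_ne
  have hpi : (Real.pi : ℂ) ≠ 0 := by exact_mod_cast Real.pi_ne_zero
  -- The integrand of the inversion formula at `-t` in ordinary frequency. The substitution `y = x /
  -- (2π)` contributes a factor `2π`, which cancels the two normalizing factors `(√(2π))⁻¹`.
  let G : ℝ → ℂ := fun y => Complex.exp (-(2 * Real.pi * Complex.I * t * y)) *
    (FourierTransform.fourier φ : 𝓢(ℝ, ℂ)) y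
  have h1 : ∀ x : ℝ, Complex.exp (-(Complex.I * t * x)) * fourierS φ x =
      ((√(2 * Real.pi) : ℝ) : ℂ)⁻¹ * G (x * (2 * Real.pi)⁻¹) := fun x => by
    rw [fourierS_apply_eq]
    have : -(Complex.I * t * x) =
        -(2 * Real.pi * Complex.I * t * ((x * (2 * Real.pi)⁻¹ : ℝ) : ℂ)) := by
      push_cast; field_simp
    simp only [G, this]; ring
  have h2 : ∫ y, G y = φ (-t) := by
    have h3 : φ (-t) = (FourierTransform.fourierInv (FourierTransform.fourier φ) : 𝓢(ℝ, ℂ)) (-t) := by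
      simp
    rw [h3, SchwartzMap.fourierInv_coe, Real.fourierInv_eq']
    congr 1; ext y
    simp only [G, smul_eq_mul, RCLike.inner_apply, conj_trivial]
    congr 2
    push_cast; ring
  rw [fourierS_apply]
  simp only [h1]
  rw [integral_const_mul, Measure.integral_comp_mul_right, h2, reflS_apply, inv_inv,
    abs_of_pos (by positivity), Complex.real_smul]
  push_cast
  field_simp
  rw [hs]

theorem reflS_sprod (φ ψ : 𝓢(ℝ, ℂ)) : reflS (sprod φ ψ) = sprod (reflS φ) (reflS ψ) := rfl

/-- The Fourier transform turns products into convolutions. -/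
theorem fourierS_sprod (φ ψ : 𝓢(ℝ, ℂ)) : fourierS (sprod φ ψ) =
    (1 / ((√(2 * Real.pi) : ℝ) : ℂ)) • sconv (fourierS φ) (fourierS ψ) := by
  apply fourierS.injective
  -- After one more transform every term contains `F²`, and the claim is that reflection is
  -- multiplicative.
  rw [map_smul, fourierS_sconv, fourierS_fourierS, fourierS_fourierS, fourierS_fourierS,
    reflS_sprod, smul_smul, one_div_mul_cancel sqrt_two_pi_ne, one_smul]

theorem fourierH_mul (u v : H) : fourierH (u * v) =
    (1 / ((√(2 * Real.pi) : ℝ) : ℂ)) • convH (fourierH u) (fourierH v) := by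
  obtain ⟨f, rfl⟩ := cls_surjective u
  obtain ⟨g, rfl⟩ := cls_surjective v
  have h : ∀ f, fourierH (cls f) = cls (mapSeq fourierS f) := fun _ => rfl
  rw [h, h, convH_cls, cls_mul, h]
  refine congrArg cls (?_ : _ = (1 / ((√(2 * Real.pi) : ℝ) : ℂ)) • (_ : Hs'))
  ext1; funext n
  exact fourierS_sprod _ _

/-- Reflection is `F²`, so it commutes with `F`; on the Fourier side the claim is again
multiplicativity of reflection. -/
theorem reflS_sconv (φ ψ : 𝓢(ℝ, ℂ)) : reflS (sconv φ ψ) = sconv (reflS φ) (reflS ψ) := by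
  apply fourierS.injective
  have h : ∀ χ, fourierS (reflS χ) = reflS (fourierS χ) := fun χ => by
    rw [← fourierS_fourierS, ← fourierS_fourierS]
  rw [h, fourierS_sconv, fourierS_sconv, h, h, map_smul, reflS_sprod]

/-- Writing the pairing as a value of a convolution turns the adjoint formula below into
associativity. -/
theorem integral_mul_eq_sconv_reflS (φ ψ : 𝓢(ℝ, ℂ)) :
    ∫ x : ℝ, φ x * ψ x = sconv (reflS φ) ψ 0 := by
  rw [sconv_apply]
  simp [reflS_apply]

/-- Convolution with `φ` is adjoint to convolution with the reflection of `φ`. -/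
theorem integral_sconv_mul (f φ ψ : 𝓢(ℝ, ℂ)) :
    ∫ x : ℝ, sconv f φ x * ψ x = ∫ x : ℝ, f x * sconv (reflS φ) ψ x := by
  rw [integral_mul_eq_sconv_reflS, integral_mul_eq_sconv_reflS, reflS_sconv, sconv_assoc]

/-! ### Hermite expansions -/

/-- The lowering operator `x/2 + d/dx` of the Hermite functions. -/
def lower : 𝓢(ℝ, ℂ) →L[ℂ] 𝓢(ℝ, ℂ) := (1 / 2 : ℂ) • X + D

/-- The raising operator `x/2 - d/dx` of the Hermite functions. -/
def raise : 𝓢(ℝ, ℂ) →L[ℂ] 𝓢(ℝ, ℂ) := (1 / 2 : ℂ) • X - D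

theorem lower_eq (φ : 𝓢(ℝ, ℂ)) : lower φ = (1 / 2 : ℂ) • X φ + D φ := rfl

theorem raise_eq (φ : 𝓢(ℝ, ℂ)) : raise φ = (1 / 2 : ℂ) • X φ - D φ := rfl

theorem raise_hermiteS (n : ℕ) :
    raise (hermiteS n) = ((√(n + 1 : ℝ) : ℝ) : ℂ) • hermiteS (n + 1) := by
  rw [raise_eq, X_hermiteS, D_hermiteS]; module

theorem lower_hermiteS_succ (n : ℕ) :
    lower (hermiteS (n + 1)) = ((√(n + 1 : ℝ) : ℝ) : ℂ) • hermiteS n := by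
  rw [lower_eq, X_hermiteS, D_hermiteS, Nat.add_sub_cancel]; push_cast; module

theorem inner_lower (φ ψ : 𝓢(ℝ, ℂ)) :
    inner ℂ (L2 (lower φ)) (L2 ψ) = inner ℂ (L2 φ) (L2 (raise ψ)) := by
  rw [lower_eq, raise_eq, map_add, map_sub, inner_add_left, inner_sub_right, map_smul, map_smul,
    inner_smul_left, inner_smul_right, inner_X, inner_D, sub_eq_add_neg]
  simp [Complex.conj_ofNat]

theorem inner_raise (φ ψ : 𝓢(ℝ, ℂ)) :
    inner ℂ (L2 (raise φ)) (L2 ψ) = inner ℂ (L2 φ) (L2 (lower ψ)) := by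
  rw [← inner_conj_symm, ← inner_lower, inner_conj_symm]

/-- The number operator of the Hermite functions, shifted by one. -/
def number : 𝓢(ℝ, ℂ) →L[ℂ] 𝓢(ℝ, ℂ) := lower ∘L raise

/-- Raising and then lowering gives the factor `√(n+1)` twice. Unlike `osc`, this operator is
diagonal in the Hermite functions. -/
theorem number_hermiteS (n : ℕ) : number (hermiteS n) = ((n : ℂ) + 1) • hermiteS n := by
  change lower (raise (hermiteS n)) = _
  rw [raise_hermiteS, map_smul, lower_hermiteS_succ, smul_smul, ← Complex.ofReal_mul,
    Real.mul_self_sqrt (by positivity)]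
  push_cast; rfl

theorem inner_number (φ ψ : 𝓢(ℝ, ℂ)) :
    inner ℂ (L2 (number φ)) (L2 ψ) = inner ℂ (L2 φ) (L2 (number ψ)) :=
  (inner_lower _ _).trans (inner_raise _ _)

theorem inner_hermiteS_number_pow (k n : ℕ) (ψ : 𝓢(ℝ, ℂ)) :
    inner ℂ (L2 (hermiteS n)) (L2 ((number ^ k) ψ)) =
      ((n : ℂ) + 1) ^ k * inner ℂ (L2 (hermiteS n)) (L2 ψ) := by
  induction k with
  | zero => simp
  | succ k ih =>
    rw [pow_succ', mul_apply_eq_comp, ← inner_number, number_hermiteS, map_smul, inner_smul_left, ih,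
      pow_succ', mul_assoc]
    simp

theorem norm_hermiteS (n : ℕ) : ‖L2 (hermiteS n)‖ = 1 := by
  induction n with
  | succ n ih => rw [norm_hermiteS_succ, ih]
  | zero =>
    have h := hnorm_eq 0 (hermiteS 0)
    rw [pow_zero, one_apply_eq_self] at h
    rw [← h, hnorm, Real.sqrt_eq_one]
    -- The square of `h_0` is the standard normal density.
    have h1 : ∀ x : ℝ, ‖((osc ^ 0) (hermiteS 0)) x‖ ^ 2 =
        (√(2 * Real.pi))⁻¹ * Real.exp (-(1 / 2) * x ^ 2) := fun x => by
      rw [pow_zero, one_apply_eq_self, hermiteS_apply, Complex.norm_real, Real.norm_eq_abs, sq_abs,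
        hermiteFn, mul_pow, mul_pow, inv_pow, Real.sq_sqrt (by positivity), ← Real.exp_nat_mul]
      simp only [Nat.factorial_zero, Polynomial.hermite_zero, map_one, Nat.cast_one, mul_one,
        one_pow]
      congr 2
      push_cast; ring
    simp only [h1]
    rw [integral_const_mul, integral_gaussian]
    have : Real.pi / (1 / 2) = 2 * Real.pi := by ring
    rw [this, inv_mul_cancel₀ (by positivity)]

/-- Eigenvectors of the symmetric operator `number` for distinct eigenvalues are orthogonal. -/
theorem orthonormal_hermiteS : Orthonormal ℂ fun n => L2 (hermiteS n) := by
  refine ⟨norm_hermiteS, fun m n hmn => ?_⟩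
  have h := inner_hermiteS_number_pow 1 m (hermiteS n)
  rw [pow_one, number_hermiteS, map_smul, inner_smul_right, pow_one] at h
  have h2 : ((n : ℂ) - m) * inner ℂ (L2 (hermiteS m)) (L2 (hermiteS n)) = 0 := by
    linear_combination h
  refine (mul_eq_zero.1 h2).resolve_left fun h3 => hmn ?_
  exact_mod_cast (sub_eq_zero.1 h3).symm

/-! ### Completeness of the Hermite functions in `L²` -/

/-- Functions annihilating the Hermite functions annihilate the monomials times the Gaussian. -/
theorem inner_X_pow_hermiteS_eq_zero (f : Lp ℂ 2 (volume : Measure ℝ))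
    (hf : ∀ n, inner ℂ (L2 (hermiteS n)) f = 0) (k : ℕ) :
    ∀ n, inner ℂ (L2 ((X ^ k) (hermiteS n))) f = 0 := by
  induction k with
  | zero => simpa using hf
  | succ k ih =>
    intro n
    -- Multiplication by `x` shifts the index both ways, so the induction hypothesis is needed at
    -- all indices.
    rw [pow_succ, mul_apply_eq_comp, X_hermiteS, map_add, map_add, inner_add_left, map_smul, map_smul,
      map_smul, map_smul, inner_smul_left, inner_smul_left, ih, ih]
    simp

theorem inner_L2_eq_integral (φ : 𝓢(ℝ, ℂ)) (f : Lp ℂ 2 (volume : Measure ℝ)) :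
    inner ℂ (L2 φ) f = ∫ x : ℝ, (starRingEnd ℂ) (φ x) * f x := by
  rw [L2.inner_def]
  refine integral_congr_ae ?_
  filter_upwards [φ.coeFn_toLp 2 volume] with x hx
  rw [L2, SchwartzMap.toLpCLM_apply, hx, RCLike.inner_apply, mul_comm]

theorem hermiteFn_zero (x : ℝ) :
    hermiteFn 0 x = (√(√(2 * Real.pi)))⁻¹ * Real.exp (-(x ^ 2) / 4) := by
  simp [hermiteFn]

theorem hermiteFn_zero_pos (x : ℝ) : 0 < hermiteFn 0 x := by
  rw [hermiteFn_zero]; positivity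

/-- This is the integrable bound for integrating the exponential series term by term. It is a
product of two `L²` functions, as the Gaussian absorbs `e^{|tx|}`. -/
theorem integrable_exp_hermiteS_mul (f : Lp ℂ 2 (volume : Measure ℝ)) (t : ℝ) :
    Integrable fun x : ℝ => Real.exp |t * x| * ‖(hermiteFn 0 x : ℂ) * f x‖ := by
  have h1 : MemLp (fun x : ℝ => Real.exp |t * x| * hermiteFn 0 x) 2 := by
    have hg : MemLp (fun x : ℝ => (√(√(2 * Real.pi)))⁻¹ * Real.exp (2 * t ^ 2) *
        Real.exp (-(1 / 8) * x ^ 2)) 2 := by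
      refine MemLp.const_mul ?_ _
      refine (memLp_two_iff_integrable_sq (by fun_prop)).2 ?_
      refine (integrable_exp_neg_mul_sq (b := 1 / 4) (by norm_num)).congr
        (Eventually.of_forall fun x => ?_)
      change _ = _ ^ 2
      rw [← Real.exp_nat_mul]
      refine congrArg Real.exp ?_
      push_cast; ring
    have hm : Continuous fun x : ℝ => Real.exp |t * x| * hermiteFn 0 x := by
      simp only [hermiteFn_zero]; fun_prop
    refine hg.mono hm.aestronglyMeasurable (Eventually.of_forall fun x => ?_)
    rw [hermiteFn_zero, Real.norm_of_nonneg (by positivity), Real.norm_of_nonneg (by positivity)]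
    rw [mul_left_comm, mul_assoc, ← Real.exp_add, ← Real.exp_add]
    -- From `(4t ± x)² ≥ 0` comes `|tx| ≤ 2t² + x²/8`, which leaves half of the exponent `-x²/4`.
    refine mul_le_mul_of_nonneg_left (Real.exp_le_exp.2 ?_) (by positivity)
    rcases abs_cases (t * x) with h | h <;> rw [h.1] <;>
      nlinarith [sq_nonneg (4 * t - x), sq_nonneg (4 * t + x)]
  have h2 : MemLp (fun x => ‖f x‖) 2 := (Lp.memLp f).norm
  refine (h1.integrable_mul h2).congr (Eventually.of_forall fun x => ?_)
  simp only [Pi.mul_apply, norm_mul, Complex.norm_real, Real.norm_of_nonneg (hermiteFn_zero_pos x).le]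
  ring

/-- Functions annihilating all Hermite functions have vanishing Fourier transform after
multiplication by the Gaussian. -/
theorem integral_exp_mul_eq_zero (f : Lp ℂ 2 (volume : Measure ℝ))
    (hf : ∀ n, inner ℂ (L2 (hermiteS n)) f = 0) (t : ℝ) :
    ∫ x : ℝ, Complex.exp (Complex.I * (t * x)) * ((hermiteFn 0 x : ℂ) * f x) = 0 := by
  have hc : Continuous fun x : ℝ => (hermiteFn 0 x : ℂ) := (hermiteS 0).continuous
  -- Each term of the exponential series is a multiple of a moment `⟨x^k h_0, f⟩`, and these vanish.
  have h0 : ∀ k : ℕ, ∫ x : ℝ, (Complex.I * (t * x)) ^ k / (k.factorial : ℂ) *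
      ((hermiteFn 0 x : ℂ) * f x) = 0 := fun k => by
    have h := inner_X_pow_hermiteS_eq_zero f hf k 0
    rw [inner_L2_eq_integral] at h
    rw [← mul_zero ((Complex.I * t) ^ k / (k.factorial : ℂ)), ← h, ← integral_const_mul]
    congr 1; ext x
    rw [X_pow_apply, hermiteS_apply, map_mul, map_pow, Complex.conj_ofReal, Complex.conj_ofReal]
    ring
  have h := hasSum_integral_of_dominated_convergence
    (F := fun (k : ℕ) (x : ℝ) => (Complex.I * (t * x)) ^ k / (k.factorial : ℂ) *
      ((hermiteFn 0 x : ℂ) * f x))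
    (f := fun x : ℝ => Complex.exp (Complex.I * (t * x)) * ((hermiteFn 0 x : ℂ) * f x))
    (μ := volume)
    (fun k x => |t * x| ^ k / (k.factorial : ℝ) * ‖(hermiteFn 0 x : ℂ) * f x‖)
    (fun k => by
      refine AEStronglyMeasurable.mul ?_ (hc.aestronglyMeasurable.mul (Lp.aestronglyMeasurable f))
      exact Continuous.aestronglyMeasurable (by fun_prop))
    (fun k => Eventually.of_forall fun x => by
      rw [norm_mul, norm_div, norm_pow, norm_mul, Complex.norm_I, one_mul, ← Complex.ofReal_mul,
        Complex.norm_real, Real.norm_eq_abs, Complex.norm_natCast])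
    (Eventually.of_forall fun x => (Real.summable_pow_div_factorial _).mul_right _)
    (by
      refine (integrable_exp_hermiteS_mul f t).congr (Eventually.of_forall fun x => ?_)
      change _ = ∑' k : ℕ, _
      rw [tsum_mul_right, Real.exp_eq_exp_ℝ, NormedSpace.exp_eq_tsum_div])
    (Eventually.of_forall fun x => by
      refine HasSum.mul_right _ ?_
      rw [Complex.exp_eq_exp_ℂ]
      exact NormedSpace.expSeries_div_hasSum_exp _)
  simp only [h0] at h
  exact h.unique hasSum_zero

/-- Completeness of the Hermite functions. -/
theorem eq_zero_of_inner_hermiteS_eq_zero (f : Lp ℂ 2 (volume : Measure ℝ))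
    (hf : ∀ n, inner ℂ (L2 (hermiteS n)) f = 0) : f = 0 := by
  set g : ℝ → ℂ := fun x => (hermiteFn 0 x : ℂ) * f x with hg
  have hc : Continuous fun x : ℝ => (hermiteFn 0 x : ℂ) := (hermiteS 0).continuous
  have hgi : Integrable g := by
    have h := integrable_exp_hermiteS_mul f 0
    simp only [zero_mul, abs_zero, Real.exp_zero, one_mul] at h
    exact (integrable_norm_iff
      (hc.aestronglyMeasurable.mul (Lp.aestronglyMeasurable f))).1 h
  have hF : FourierTransform.fourier g = 0 := by
    ext s
    rw [Real.fourier_eq']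
    rw [Pi.zero_apply, ← integral_exp_mul_eq_zero f hf (-(2 * Real.pi * s))]
    congr 1; ext x
    rw [smul_eq_mul, RCLike.inner_apply, conj_trivial]
    congr 2
    push_cast; ring
  have hz : ∀ᵐ x, g x = 0 := by
    refine ae_eq_zero_of_integral_contDiff_smul_eq_zero hgi.locallyIntegrable fun χ hχ hχc => ?_
    have h1 : HasCompactSupport fun x => (χ x : ℂ) := hχc.comp_left Complex.ofReal_zero
    have h2 : ContDiff ℝ (⊤ : ℕ∞) fun x => (χ x : ℂ) := Complex.ofRealCLM.contDiff.comp hχ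
    set φ : 𝓢(ℝ, ℂ) := h1.toSchwartzMap h2 with hφ
    -- The test function is the transform of `F⁻¹ φ`; moving the transform to `g`, where it
    -- vanishes, shows that `g` integrates to zero against it.
    have h3 := VectorFourier.integral_fourierIntegral_smul_eq_flip (L := innerₗ ℝ)
      Real.continuous_fourierChar continuous_inner
      ((FourierTransform.fourierInv φ : 𝓢(ℝ, ℂ)).integrable (μ := volume)) hgi
    rw [flip_innerₗ] at h3
    change ∫ ξ, FourierTransform.fourier ((FourierTransform.fourierInv φ : 𝓢(ℝ, ℂ)) : ℝ → ℂ) ξ •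
      g ξ = ∫ x, (FourierTransform.fourierInv φ : 𝓢(ℝ, ℂ)) x • FourierTransform.fourier g x at h3
    rw [hF, ← SchwartzMap.fourier_coe, FourierTransform.fourier_fourierInv_eq] at h3
    simpa [hφ] using h3
  rw [Lp.eq_zero_iff_ae_eq_zero]
  filter_upwards [hz] with x hx
  -- The Gaussian `h_0` has no zeros, so it can be divided out.
  refine (mul_eq_zero.1 hx).resolve_left ?_
  exact_mod_cast (hermiteFn_zero_pos x).ne'

/-- The Hermite functions as a Hilbert basis of `L²`. -/
def hermiteBasis : HilbertBasis ℕ ℂ (Lp ℂ 2 (volume : Measure ℝ)) :=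
  HilbertBasis.mkOfOrthogonalEqBot orthonormal_hermiteS (by
    rw [Submodule.eq_bot_iff]
    intro f hf
    refine eq_zero_of_inner_hermiteS_eq_zero f fun n => ?_
    exact (Submodule.mem_orthogonal _ _).1 hf _ (Submodule.subset_span ⟨n, rfl⟩))

theorem hermiteBasis_apply (n : ℕ) : hermiteBasis n = L2 (hermiteS n) := by
  rw [hermiteBasis, HilbertBasis.coe_mkOfOrthogonalEqBot]

/-! ### Convergence of Hermite expansions in the Schwartz space -/

/-- The partial sums of the Hermite expansion of a Schwartz function. -/
def hermiteProj (n : ℕ) (ψ : 𝓢(ℝ, ℂ)) : 𝓢(ℝ, ℂ) :=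
  ∑ j ∈ Finset.range (n + 1), inner ℂ (L2 (hermiteS j)) (L2 ψ) • hermiteS j

theorem hermiteProj_sub (n : ℕ) (φ ψ : 𝓢(ℝ, ℂ)) :
    hermiteProj n (φ - ψ) = hermiteProj n φ - hermiteProj n ψ := by
  simp only [hermiteProj, map_sub, inner_sub_right, sub_smul, Finset.sum_sub_distrib]

theorem tendsto_L2_hermiteProj (ψ : 𝓢(ℝ, ℂ)) :
    Tendsto (fun n => L2 (hermiteProj n ψ)) atTop (𝓝 (L2 ψ)) := by
  -- The shift by one matches the projections, which include the index `n`.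
  have h := (hermiteBasis.hasSum_repr (L2 ψ)).tendsto_sum_nat.comp (tendsto_add_atTop_nat 1)
  refine h.congr fun n => ?_
  simp [hermiteProj, map_sum, hermiteBasis.repr_apply_apply, hermiteBasis_apply]

/-- Hermite coefficients are rapidly decreasing, uniformly on bounded sets. -/
theorem norm_inner_hermiteS_le (k : ℕ) : ∃ (r : ℕ) (C : ℝ), 0 ≤ C ∧ ∀ (n : ℕ) (ψ : 𝓢(ℝ, ℂ)),
    ((n : ℝ) + 1) ^ k * ‖inner ℂ (L2 (hermiteS n)) (L2 ψ)‖ ≤ C * hnorm r ψ := by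
  -- The factor `(n+1)^k` is absorbed by `number ^ k` acting on `ψ`; Cauchy-Schwarz with `‖h_n‖ = 1`
  -- and continuity of `number ^ k` finish the estimate.
  obtain ⟨r, C, hC, h⟩ := map_bound (number ^ k) 0
  refine ⟨r, C, hC, fun n ψ => ?_⟩
  have h1 := congrArg norm (inner_hermiteS_number_pow k n ψ)
  have h2 : ‖(n : ℂ) + 1‖ = (n : ℝ) + 1 := by exact_mod_cast Complex.norm_natCast (n + 1)
  rw [norm_mul, norm_pow, h2] at h1
  rw [← h1]
  refine (norm_inner_le_norm _ _).trans ?_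
  have h3 := h ψ
  rw [hnorm_eq, pow_zero, one_apply_eq_self] at h3
  rwa [norm_hermiteS, one_mul]

/-- The Hermite projections are equicontinuous on the Schwartz space. -/
theorem hnorm_hermiteProj_le (m : ℕ) : ∃ (r : ℕ) (C : ℝ), 0 ≤ C ∧ ∀ (n : ℕ) (ψ : 𝓢(ℝ, ℂ)),
    hnorm m (hermiteProj n ψ) ≤ C * hnorm r ψ := by
  obtain ⟨K, p, hK, hh⟩ := hnorm_hermiteS m
  -- The power `p` offsets the growth of `hnorm m` on the Hermite functions; the remaining `2` makes
  -- the series summable.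
  obtain ⟨r, C, hC, h⟩ := norm_inner_hermiteS_le (p + 2)
  have hs : Summable fun j : ℕ => 1 / ((j : ℝ) + 1) ^ 2 := by
    simpa using (summable_nat_add_iff 1).2 (Real.summable_one_div_nat_pow.2 one_lt_two)
  refine ⟨r, K * C * ∑' j : ℕ, 1 / ((j : ℝ) + 1) ^ 2, by positivity, fun n ψ => ?_⟩
  have h0 := hnorm_nonneg r ψ
  have h1 : hnorm m (hermiteProj n ψ) ≤ ∑ j ∈ Finset.range (n + 1),
      ‖inner ℂ (L2 (hermiteS j)) (L2 ψ)‖ * hnorm m (hermiteS j) := by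
    simp only [hermiteProj, hnorm_eq, map_sum, map_smul]
    refine (norm_sum_le _ _).trans (le_of_eq ?_)
    simp only [norm_smul]
  have h2 : ∀ j : ℕ, ‖inner ℂ (L2 (hermiteS j)) (L2 ψ)‖ * hnorm m (hermiteS j) ≤
      K * C * hnorm r ψ * (1 / ((j : ℝ) + 1) ^ 2) := fun j => by
    have hj : (0 : ℝ) < (j : ℝ) + 1 := by positivity
    rw [mul_one_div, le_div_iff₀ (by positivity)]
    calc _ ≤ ‖inner ℂ (L2 (hermiteS j)) (L2 ψ)‖ * (K * ((j : ℝ) + 1) ^ p) * ((j : ℝ) + 1) ^ 2 := by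
          gcongr; exact hh j
      _ = K * (((j : ℝ) + 1) ^ (p + 2) * ‖inner ℂ (L2 (hermiteS j)) (L2 ψ)‖) := by ring
      _ ≤ K * (C * hnorm r ψ) := mul_le_mul_of_nonneg_left (h j ψ) hK
      _ = _ := by ring
  refine h1.trans ((Finset.sum_le_sum fun j _ => h2 j).trans ?_)
  rw [← Finset.mul_sum]
  calc _ ≤ K * C * hnorm r ψ * ∑' j : ℕ, 1 / ((j : ℝ) + 1) ^ 2 :=
        mul_le_mul_of_nonneg_left (hs.sum_le_tsum _ fun j _ => by positivity) (by positivity)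
    _ = _ := by ring

theorem inner_osc (φ ψ : 𝓢(ℝ, ℂ)) :
    inner ℂ (L2 (osc φ)) (L2 ψ) = inner ℂ (L2 φ) (L2 (osc ψ)) := by
  simp only [osc_eq, map_smul, map_add, map_neg, inner_smul_left, inner_smul_right,
    inner_add_left, inner_add_right, inner_neg_left, inner_neg_right, inner_D, inner_X]
  simp [Complex.conj_ofNat]

theorem inner_osc_pow (m : ℕ) (φ ψ : 𝓢(ℝ, ℂ)) :
    inner ℂ (L2 ((osc ^ m) φ)) (L2 ψ) = inner ℂ (L2 φ) (L2 ((osc ^ m) ψ)) := by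
  induction m generalizing φ ψ with
  | zero => simp
  | succ m ih =>
    rw [pow_succ, mul_apply_eq_comp, ih, inner_osc, ← mul_apply_eq_comp, ← pow_succ', pow_succ]

/-- Symmetry of `osc` moves all powers to one side, and Cauchy-Schwarz follows. A sequence that is
bounded in every norm and tends to zero in `L²` thus tends to zero in every norm. -/
theorem hnorm_sq_le (m : ℕ) (φ : 𝓢(ℝ, ℂ)) : hnorm m φ ^ 2 ≤ hnorm 0 φ * hnorm (m + m) φ := by
  rw [hnorm_eq, hnorm_eq, hnorm_eq, ← inner_self_eq_norm_sq (𝕜 := ℂ), inner_osc_pow,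
    ← mul_apply_eq_comp, ← pow_add, pow_zero, one_apply_eq_self]
  exact re_inner_le_norm _ _

/-- Hermite expansions of Schwartz functions converge in the Schwartz space. -/
theorem tendsto_hnorm_hermiteProj_sub (m : ℕ) (ψ : 𝓢(ℝ, ℂ)) :
    Tendsto (fun n => hnorm m (hermiteProj n ψ - ψ)) atTop (𝓝 0) := by
  -- The interpolation uses the norm of index `2m`, where only boundedness in `n` is needed.
  obtain ⟨r, C, hC, h⟩ := hnorm_hermiteProj_le (m + m)
  have h0 : Tendsto (fun n => hnorm 0 (hermiteProj n ψ - ψ)) atTop (𝓝 0) := by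
    have := tendsto_iff_norm_sub_tendsto_zero.1 (tendsto_L2_hermiteProj ψ)
    refine this.congr fun n => ?_
    rw [hnorm_eq, pow_zero, one_apply_eq_self, map_sub]
  have h1 : Tendsto (fun n => hnorm m (hermiteProj n ψ - ψ) ^ 2) atTop (𝓝 0) := by
    refine squeeze_zero (fun n => sq_nonneg _) (fun n => ?_)
      (by simpa using h0.mul_const (C * hnorm r ψ + hnorm (m + m) ψ))
    refine (hnorm_sq_le m _).trans (mul_le_mul_of_nonneg_left ?_ (hnorm_nonneg _ _))
    exact (hnorm_sub_le _ _ _).trans (add_le_add_left (h n ψ) _)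
  have h2 := h1.sqrt
  rw [Real.sqrt_zero] at h2
  exact h2.congr fun n => Real.sqrt_sq (hnorm_nonneg _ _)

/-! ### Association -/

/-- Hermite functions are real, so the bilinear pairing of distributions agrees with the inner
product. -/
theorem integral_hermiteS_mul (n : ℕ) (ψ : 𝓢(ℝ, ℂ)) :
    ∫ x : ℝ, hermiteS n x * ψ x = inner ℂ (L2 (hermiteS n)) (L2 ψ) := by
  simp only [inner_L2, hermiteS_apply, Complex.conj_ofReal]

theorem partialSum_toTemperedDistribution (φ : 𝓢(ℝ, ℂ)) (n : ℕ) :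
    partialSum (SchwartzMap.toTemperedDistributionCLM ℝ ℂ volume φ) n = hermiteProj n φ := by
  simp only [partialSum, hermiteProj, SchwartzMap.toTemperedDistributionCLM_apply_apply, smul_eq_mul,
    integral_hermiteS_mul]

/-- The truncation passes from `T` to the test function: both sides equal `∑ T(h_j) ⟨h_j, χ⟩`. -/
theorem integral_partialSum_mul (T : 𝓢'(ℝ, ℂ)) (n : ℕ) (χ : 𝓢(ℝ, ℂ)) :
    ∫ x : ℝ, partialSum T n x * χ x = T (hermiteProj n χ) := by
  have h : ∫ x : ℝ, partialSum T n x * χ x =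
      SchwartzMap.toTemperedDistributionCLM ℝ ℂ volume χ (partialSum T n) := by
    simp [SchwartzMap.toTemperedDistributionCLM_apply_apply]
  rw [h, partialSum, hermiteProj, map_sum, map_sum]
  refine Finset.sum_congr rfl fun j _ => ?_
  have hj : SchwartzMap.toTemperedDistributionCLM ℝ ℂ volume χ (hermiteS j) =
      inner ℂ (L2 (hermiteS j)) (L2 χ) := by
    simp only [SchwartzMap.toTemperedDistributionCLM_apply_apply, smul_eq_mul,
      integral_hermiteS_mul]
  rw [map_smul, map_smul]
  exact (congrArg (T (hermiteS j) • ·) hj).trans (mul_comm _ _)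

theorem tendsto_apply_of_tendsto_hnorm (T : 𝓢'(ℝ, ℂ)) {f : ℕ → 𝓢(ℝ, ℂ)} {φ : 𝓢(ℝ, ℂ)}
    (hf : ∀ m, Tendsto (fun n => hnorm m (f n - φ)) atTop (𝓝 0)) :
    Tendsto (fun n => T (f n)) atTop (𝓝 (T φ)) := by
  obtain ⟨r, C, -, h⟩ := functional_bound T
  rw [tendsto_iff_norm_sub_tendsto_zero]
  refine squeeze_zero (fun n => norm_nonneg _) (fun n => ?_) (by simpa using (hf r).const_mul C)
  rw [← map_sub]
  exact h _

/-- The Hermite projections converge uniformly on convergent sequences. -/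
theorem tendsto_hnorm_hermiteProj_of_tendsto {f : ℕ → 𝓢(ℝ, ℂ)} {φ : 𝓢(ℝ, ℂ)}
    (hf : ∀ m, Tendsto (fun n => hnorm m (f n - φ)) atTop (𝓝 0)) (m : ℕ) :
    Tendsto (fun n => hnorm m (hermiteProj n (f n) - φ)) atTop (𝓝 0) := by
  obtain ⟨r, C, -, h⟩ := hnorm_hermiteProj_le m
  refine squeeze_zero (fun n => hnorm_nonneg _ _) (fun n => ?_)
    (by simpa using ((hf r).const_mul C).add (tendsto_hnorm_hermiteProj_sub m φ))
  -- Equicontinuity controls the first summand, convergence of the expansion of the fixed `φ` the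
  -- second.
  have e : hermiteProj n (f n) - φ = hermiteProj n (f n - φ) + (hermiteProj n φ - φ) := by
    rw [hermiteProj_sub]; abel
  rw [e]
  exact (hnorm_add_le _ _ _).trans (add_le_add_left (h n _) _)

theorem tendsto_hnorm_map (A : 𝓢(ℝ, ℂ) →L[ℂ] 𝓢(ℝ, ℂ)) {f : ℕ → 𝓢(ℝ, ℂ)} {φ : 𝓢(ℝ, ℂ)}
    (hf : ∀ m, Tendsto (fun n => hnorm m (f n - φ)) atTop (𝓝 0)) (m : ℕ) :
    Tendsto (fun n => hnorm m (A (f n) - A φ)) atTop (𝓝 0) := by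
  obtain ⟨r, C, -, h⟩ := map_bound A m
  refine squeeze_zero (fun n => hnorm_nonneg _ _) (fun n => ?_) (by simpa using (hf r).const_mul C)
  rw [← map_sub]
  exact h _

/-- The regularizations of a tempered distribution converge on convergent test functions. -/
theorem tendsto_integral_partialSum_mul (T : 𝓢'(ℝ, ℂ)) {f : ℕ → 𝓢(ℝ, ℂ)} {φ : 𝓢(ℝ, ℂ)}
    (hf : ∀ m, Tendsto (fun n => hnorm m (f n - φ)) atTop (𝓝 0)) :
    Tendsto (fun n => ∫ x : ℝ, partialSum T n x * f n x) atTop (𝓝 (T φ)) := by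
  simp only [integral_partialSum_mul]
  exact tendsto_apply_of_tendsto_hnorm T (tendsto_hnorm_hermiteProj_of_tendsto hf)

theorem IsRapid.tendsto_zero {a : ℕ → ℝ} (ha : IsRapid a) : Tendsto a atTop (𝓝 0) := by
  have h := (ha 0).tendsto_atTop_zero
  simp only [mul_zero, pow_zero, one_mul] at h
  have h2 := h.sqrt
  simp only [Real.sqrt_zero, Real.sqrt_sq (abs_nonneg _)] at h2
  exact (tendsto_zero_iff_abs_tendsto_zero a).2 h2

/-- Negligible sequences tend to zero in the Schwartz space, and pairing with `φ` is continuous.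
Hence association does not depend on representatives. -/
theorem tendsto_integral_of_mem_Hs {f : ℕ → 𝓢(ℝ, ℂ)} (hf : f ∈ Hs) (φ : 𝓢(ℝ, ℂ)) :
    Tendsto (fun n => ∫ x : ℝ, f n x * φ x) atTop (𝓝 0) := by
  have h := tendsto_apply_of_tendsto_hnorm
    (SchwartzMap.toTemperedDistributionCLM ℝ ℂ volume φ) (f := f) (φ := 0)
    (fun m => by simpa using (hf m).tendsto_zero)
  rw [map_zero] at h
  exact h.congr fun n => by simp [SchwartzMap.toTemperedDistributionCLM_apply_apply]

theorem integral_sub_mul (f g φ : 𝓢(ℝ, ℂ)) : ∫ x : ℝ, (f x - g x) * φ x =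
    (∫ x : ℝ, f x * φ x) - ∫ x : ℝ, g x * φ x := by
  simp only [sub_mul]
  exact integral_sub (sprod f φ).integrable (sprod g φ).integrable

/-- Association can be tested on one pair of representatives. -/
theorem assoc_cls {f g : Hs'} (h : ∀ φ : 𝓢(ℝ, ℂ),
    Tendsto (fun n => ∫ x : ℝ, (f.1 n x - g.1 n x) * φ x) atTop (𝓝 0)) :
    Assoc (cls f) (cls g) := by
  intro f' g' hf hg φ
  have h1 := tendsto_integral_of_mem_Hs ((cls_eq_iff _ _).1 hf) φ
  have h2 := tendsto_integral_of_mem_Hs ((cls_eq_iff _ _).1 hg) φ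
  -- This is `f' - g' = (f' - f) + (f - g) - (g' - g)`.
  have h3 := (h1.add (h φ)).sub h2
  rw [add_zero, sub_zero] at h3
  refine h3.congr fun n => ?_
  simp only [Pi.sub_apply, sub_apply, integral_sub_mul]
  ring

/-- The convolution of a tempered distribution and a Schwartz function is associated with the
convolution of their classes. -/
theorem assoc_convH_iota (T : 𝓢'(ℝ, ℂ)) (φ : 𝓢(ℝ, ℂ)) :
    Assoc (convH (iota T) (iota (SchwartzMap.toTemperedDistributionCLM ℝ ℂ volume φ)))
      (iota (convDist T φ)) := by
  rw [iota, iota, iota, convH_cls]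
  refine assoc_cls fun ψ => ?_
  -- After passing to the adjoint, the test function still depends on `n` through the truncation of
  -- `φ`; it converges because `χ ↦ ψ ∗ χ̃` is continuous.
  have h1 : ∀ m, Tendsto (fun n => hnorm m
      (sconv (reflS (hermiteProj n φ)) ψ - sconv (reflS φ) ψ)) atTop (𝓝 0) := fun m => by
    simp only [sconv_comm _ ψ]
    exact tendsto_hnorm_map
      (SchwartzMap.convolution (ContinuousLinearMap.mul ℂ ℂ) ψ ∘L reflS)
      (fun m => tendsto_hnorm_hermiteProj_sub m φ) m
  have h2 := tendsto_integral_partialSum_mul T h1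
  -- Here the test function is constant in `n`; the limit is `T(φ̃ ∗ ψ)`, the same as in `h2`.
  have h3 := tendsto_integral_partialSum_mul (convDist T φ) (f := fun _ => ψ) (φ := ψ)
    (fun m => by simp [hnorm_zero_right])
  rw [convDist_apply] at h3
  have h4 := h2.sub h3
  rw [sub_self] at h4
  refine h4.congr fun n => ?_
  rw [integral_sub_mul, integral_sconv_mul, ← partialSum_toTemperedDistribution]

end TGF

end

theorem mainTheorem4 :
    -- the convolution of classes is the class of the term by term convolution
    (∀ f g : TGF.Hs', ∃ h : (fun n => TGF.sconv (f.1 n) (g.1 n)) ∈ TGF.Hs',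
      TGF.convH (TGF.cls f) (TGF.cls g) = TGF.cls ⟨fun n => TGF.sconv (f.1 n) (g.1 n), h⟩) ∧
    -- commutativity, derivatives, associativity
    (∀ (u v w : TGF.H) (α : ℕ),
      TGF.convH u v = TGF.convH v u ∧
      TGF.DH^[α] (TGF.convH u v) = TGF.convH (TGF.DH^[α] u) v ∧
      TGF.convH (TGF.convH u v) w = TGF.convH u (TGF.convH v w)) ∧
    -- exchange formulas
    (∀ u v : TGF.H,
      TGF.fourierH (u * v) =
        (1 / ((√(2 * Real.pi) : ℝ) : ℂ)) • TGF.convH (TGF.fourierH u) (TGF.fourierH v) ∧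
      TGF.fourierH (TGF.convH u v) =
        ((√(2 * Real.pi) : ℝ) : ℂ) • (TGF.fourierH u * TGF.fourierH v)) ∧
    -- convolution of a tempered distribution and a Schwartz function, up to association
    (∀ (T : 𝓢'(ℝ, ℂ)) (φ : 𝓢(ℝ, ℂ)),
      TGF.Assoc
        (TGF.convH (TGF.iota T) (TGF.iota (SchwartzMap.toTemperedDistributionCLM ℝ ℂ volume φ)))
        (TGF.iota (TGF.convDist T φ))) := by
  refine ⟨fun f g => ⟨TGF.sconv_mem f g, TGF.convH_cls f g⟩, fun u v w α => ?_, fun u v => ?_,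
    TGF.assoc_convH_iota⟩
  · exact ⟨TGF.convH_comm u v, TGF.DH_iterate_convH u v α, TGF.convH_assoc u v w⟩
  · exact ⟨TGF.fourierH_mul u v, TGF.fourierH_convH u v⟩
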